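/- Let $\Omega\subset\mathbb R^n$ be a bounded domain (open, connected, nonempty), let $\mu_1,\mu_2,\mu_3,\alpha,\beta,\gamma>0$ be fixed and let $\delta>0$ be the control parameter. Put $$\sigma=\tfrac1{2\beta}\Big[(1-\gamma-\beta)+\sqrt{(1-\gamma-\beta)^2+4\beta(1+\gamma)}\Big],$$ $$a=\tfrac\alpha2(3\beta\sigma+\gamma-1)+\tfrac1\alpha(\sigma+1),\quad b=(1-\beta)\sigma-2\beta\sigma^2-\gamma,\quad c=\sigma(2\beta\sigma+\beta+\gamma-1),\quad C(\delta)=\delta c .$$ Consider the eigenvalue problem, for $\lambda\in\mathbb C$ and $0\ne u=(u_1,u_2,u_3)\in H^2(\Omega;\mathbb C)^3$, $$\begin{aligned} &\mu_1\Delta u_1-\alpha\big[\tfrac12(\gamma+3\beta\sigma-1)u_1+(\sigma-1)u_2\big]=\lambda u_1,\\ &\mu_2\Delta u_2-\tfrac1\alpha\big[\tfrac12(1+\gamma-\beta\sigma)u_1+(\sigma+1)u_2-\gamma u_3\big]=\lambda u_2,\\ &\mu_3\Delta u_3+\delta(u_1-u_3)=\lambda u_3,\qquad \tfrac{\partial u}{\partial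 n}\big|_{\partial\Omega}=0, \end{aligned}\tag{E}$$ where the Neumann condition for $u\in H^2(\Omega)$ means $\int_\Omega\nabla u\cdot\nabla\psi=-\int_\Omega(\Delta u)\psi$ for all $\psi\in H^1(\Omega)$. Let $\mathcal S$ be the set of Neumann eigenvalues, i.e. of the $\rho\in\mathbb R$ for which $\Delta e=-\rho e$, $\partial e/\partial n|_{\partial\Omega}=0$ has a solution $0\neq e\in H^2(\Omega)$. For $\rho\in\mathcal S$ let $\beta_{\rho,1}(\delta),\beta_{\rho,2}(\delta),\beta_{\rho,3}(\delta)$ be the eigenvalues, with algebraic multiplicity, of $$M_\rho(\delta)=\begin{pmatrix}-\mu_1\rho-\frac\alpha2(\gamma+3\beta\sigma-1)&-\alpha(\sigma-1)&0\\-\frac1{2\alpha}(1+\gamma-\beta\sigma)&-\mu_2\rho-\frac1\alpha(\sigma+1)&\frac\gamma\alpha\\\delta&0&-\mu_3\rho-\delta\end{pmatrix}.$$ Let $$\delta_0=\frac{c+b-a^2+\sqrt{(c+b-a^2)^2+4a^2b}}{2a},$$ and let $\delta_1$ be the number with $$\delta_1=\max_{\rho\in\mathcal S,\ \rho\ne0}F(\rho),\qquad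 F(\rho)=\frac{\mu_3\rho b-C(\delta_1)}{\big(\frac{\sigma+1}\alpha\mu_1+\frac\alpha2(3\beta\sigma+\gamma-1)\mu_2\big)\rho+\mu_1\mu_2\rho^2}-\mu_3\rho .$$ Call $\rho\in\mathcal S\setminus\{0\}$ critical if $F(\rho)=\delta_1$. Then the $\beta_{\rho,j}(\delta)$ can be numbered, for all $\rho\in\mathcal S$ and $\delta>0$, so that the following hold. For every $\delta>0$ the eigenvalues of (E) are exactly the numbers $\beta_{\rho,j}(\delta)$, $\rho\in\mathcal S$, $1\le j\le3$. Moreover $0\in\mathcal S$, and its Neumann eigenfunctions are constant. If $b<0$, then for every $\delta>0$ all eigenvalues of (E) have negative real part. If $b>0$ and $\delta_1$ exists (the maximum is attained), then: (1) Let $\delta_0<\delta_1$. For every critical $\rho_*$, the eigenvalue $\beta_{\rho_*,1}(\delta)$ is real for all $\delta>0$, with $$\beta_{\rho_*,1}(\delta)<0\ \text{ if }\delta>\delta_1,\qquad \beta_{\rho_*,1}(\delta_1)=0,\qquad \beta_{\rho_*,1}(\delta)>0\ \text{ if }0<\delta<\delta_1;$$ for some $\varepsilon>0$ it is continuous in $\delta$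 and is a simple eigenvalue of $M_{\rho_*}(\delta)$ for $0<\delta<\delta_1+\varepsilon$; and all three $\beta_{\rho_*,j}(\delta)$ have negative real part if $\delta>\delta_1$. Further, $\operatorname{Re}\beta_{\rho,j}(\delta_1)<0$ for all $(\rho,j)$ except those with $\rho$ critical and $j=1$. (2) Let $\delta_0>\delta_1$. For some $\varepsilon>0$ and all $\delta$ with $|\delta-\delta_0|<\varepsilon$, $\beta_{0,1}(\delta)=\overline{\beta_{0,2}(\delta)}$ is non-real and depends continuously on $\delta$. For $j=1,2$ and all $\delta>0$, $$\operatorname{Re}\beta_{0,j}(\delta)<0\ \text{ if }\delta>\delta_0,\qquad \operatorname{Re}\beta_{0,j}(\delta_0)=0,\qquad \operatorname{Re}\beta_{0,j}(\delta)>0\ \text{ if }\delta<\delta_0 .$$ Further, $\operatorname{Re}\beta_{\rho,j}(\delta_0)<0$ for all $(\rho,j)\ne(0,1),(0,2)$. -/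

import Mathlib

open MeasureTheory Set
open scoped ContDiff

noncomputable section

namespace BZ

/-! ### Sobolev spaces and the Neumann Laplacian on a domain of `ℝⁿ` -/

/-- Euclidean space `ℝⁿ`. -/
abbrev E (n : ℕ) : Type := EuclideanSpace ℝ (Fin n)

/-- `u ∈ L²(Ω; ℂ)`. -/
def MemL2 {n : ℕ} (Ω : Set (E n)) (u : E n → ℂ) : Prop :=
  MemLp u 2 (volume.restrict Ω)

/-- Test functions: real smooth functions with compact support inside `Ω`. -/
def IsTest {n : ℕ} (Ω : Set (E n)) (φ : E n → ℝ) : Prop :=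
  ContDiff ℝ ∞ φ ∧ HasCompactSupport φ ∧ tsupport φ ⊆ Ω

/-- `g` is the weak partial derivative `∂ᵢ u` on `Ω`. -/
def HasWeakPartial {n : ℕ} (Ω : Set (E n)) (i : Fin n) (u g : E n → ℂ) : Prop :=
  ∀ φ : E n → ℝ, IsTest Ω φ →
    ∫ x in Ω, (fderiv ℝ φ x (EuclideanSpace.single i 1)) • u x = - ∫ x in Ω, φ x • g x

/-- `u ∈ H¹(Ω; ℂ)` with weak gradient `g`. -/
def IsH1 {n : ℕ} (Ω : Set (E n)) (u : E n → ℂ) (g : Fin n → E n → ℂ) : Prop :=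
  MemL2 Ω u ∧ ∀ i, MemL2 Ω (g i) ∧ HasWeakPartial Ω i u (g i)

/-- `u ∈ H²(Ω; ℂ)` with weak gradient `g` and weak Hessian `h`. -/
def IsH2 {n : ℕ} (Ω : Set (E n)) (u : E n → ℂ) (g : Fin n → E n → ℂ)
    (h : Fin n → Fin n → E n → ℂ) : Prop :=
  IsH1 Ω u g ∧ ∀ i, IsH1 Ω (g i) (h i)

/-- `u ∈ H²(Ω; ℂ)`, `∂u/∂n = 0` on `∂Ω`, and `Δu = v` on `Ω`. The Neumann condition is
expressed by the vanishing of the boundary term in Green's formula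
`∫_Ω ∇u · ∇ψ = - ∫_Ω (Δu) ψ + ∫_{∂Ω} (∂u/∂n) ψ`, for all `ψ ∈ H¹(Ω; ℂ)`. -/
def NeumannLaplacian {n : ℕ} (Ω : Set (E n)) (u v : E n → ℂ) : Prop :=
  ∃ (g : Fin n → E n → ℂ) (h : Fin n → Fin n → E n → ℂ),
    IsH2 Ω u g h ∧
    (∀ᵐ x ∂(volume.restrict Ω), v x = ∑ i, h i i x) ∧
    ∀ (ψ : E n → ℂ) (q : Fin n → E n → ℂ), IsH1 Ω ψ q →
      ∫ x in Ω, ∑ i, g i x * q i x = - ∫ x in Ω, v x * ψ x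

/-- `e ≠ 0`, `Δe = -ρ e` in `Ω` and `∂e/∂n = 0` on `∂Ω`. -/
def IsNeumannEigenfunction {n : ℕ} (Ω : Set (E n)) (ρ : ℝ) (e : E n → ℂ) : Prop :=
  NeumannLaplacian Ω e (fun x => -(ρ : ℂ) * e x) ∧
    ¬ (∀ᵐ x ∂(volume.restrict Ω), e x = 0)

/-- The set `{ρ₁, ρ₂, …}` of the eigenvalues of the Neumann Laplacian. -/
def neumannSpectrum {n : ℕ} (Ω : Set (E n)) : Set ℝ :=
  {ρ | ∃ e, IsNeumannEigenfunction Ω ρ e}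

/-! ### The parameters -/

/-- The positive parameters of the model, other than the control parameter `δ`. -/
structure Params where
  (μ₁ μ₂ μ₃ α β γ : ℝ)
  μ₁_pos : 0 < μ₁
  μ₂_pos : 0 < μ₂
  μ₃_pos : 0 < μ₃
  α_pos : 0 < α
  β_pos : 0 < β
  γ_pos : 0 < γ

namespace Params

/-- The first (and third) component of the positive constant steady state. -/
def σ (p : Params) : ℝ :=
  1 / (2 * p.β) *
    ((1 - p.γ - p.β) + Real.sqrt ((1 - p.γ - p.β) ^ 2 + 4 * p.β * (1 + p.γ)))

def a (p : Params) : ℝ :=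
  p.α / 2 * (3 * p.β * p.σ + p.γ - 1) + 1 / p.α * (p.σ + 1)

def b (p : Params) : ℝ := (1 - p.β) * p.σ - 2 * p.β * p.σ ^ 2 - p.γ

def c (p : Params) : ℝ := p.σ * (2 * p.β * p.σ + p.β + p.γ - 1)

/-- The coefficient `C = C(δ)`. -/
def C (p : Params) (δ : ℝ) : ℝ := δ * p.σ * (2 * p.β * p.σ + p.β + p.γ - 1)

def δ₀ (p : Params) : ℝ :=
  (p.c + p.b - p.a ^ 2 + Real.sqrt ((p.c + p.b - p.a ^ 2) ^ 2 + 4 * p.a ^ 2 * p.b)) / (2 * p.a)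

/-- The expression whose maximum over the nonzero Neumann eigenvalues `ρ` is `δ₁`.
It involves `δ` through `C`. -/
def critExpr (p : Params) (δ ρ : ℝ) : ℝ :=
  (p.μ₃ * ρ * p.b - p.C δ) /
      (((p.σ + 1) / p.α * p.μ₁ + p.α / 2 * (3 * p.β * p.σ + p.γ - 1) * p.μ₂) * ρ
        + p.μ₁ * p.μ₂ * ρ ^ 2)
    - p.μ₃ * ρ

/-- `δ₁` is the critical number `max_{ρ_k ≠ 0} critExpr`, where `C` is taken at `δ₁` itself. -/
def IsDelta₁ {n : ℕ} (Ω : Set (E n)) (p : Params) (δ₁ : ℝ) : Prop :=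
  IsGreatest {y | ∃ ρ ∈ neumannSpectrum Ω, ρ ≠ 0 ∧ y = p.critExpr δ₁ ρ} δ₁

/-- The maximum in the definition of `δ₁` is reached at the Neumann eigenvalue `ρ`. -/
def IsCriticalMode {n : ℕ} (Ω : Set (E n)) (p : Params) (δ₁ ρ : ℝ) : Prop :=
  ρ ∈ neumannSpectrum Ω ∧ ρ ≠ 0 ∧ p.critExpr δ₁ ρ = δ₁

/-- The matrix `M_k` of the linearization on the mode with Neumann eigenvalue `ρ = ρ_k`. -/
def M (p : Params) (ρ δ : ℝ) : Matrix (Fin 3) (Fin 3) ℝ :=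
  !![-p.μ₁ * ρ - p.α / 2 * (p.γ + 3 * p.β * p.σ - 1), -p.α * (p.σ - 1), 0;
     -(1 / (2 * p.α)) * (1 + p.γ - p.β * p.σ), -p.μ₂ * ρ - 1 / p.α * (p.σ + 1), p.γ / p.α;
     δ, 0, -p.μ₃ * ρ - δ]

/-- `u = (u₁, u₂, u₃) ≠ 0` (here `u 0, u 1, u 2`) is an eigenfunction, with eigenvalue `z`, of
the linearization at the positive constant steady state, under the Neumann condition. -/
def IsEigenfunction {n : ℕ} (Ω : Set (E n)) (p : Params) (δ : ℝ) (z : ℂ)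
    (u : Fin 3 → E n → ℂ) : Prop :=
  ¬ (∀ᵐ x ∂(volume.restrict Ω), ∀ i, u i x = 0) ∧
  ∃ v : Fin 3 → E n → ℂ, (∀ i, NeumannLaplacian Ω (u i) (v i)) ∧
    ∀ᵐ x ∂(volume.restrict Ω),
      p.μ₁ * v 0 x - p.α * (1 / 2 * (p.γ + 3 * p.β * p.σ - 1) * u 0 x + (p.σ - 1) * u 1 x)
        = z * u 0 x ∧
      p.μ₂ * v 1 x - 1 / p.α * (1 / 2 * (1 + p.γ - p.β * p.σ) * u 0 x + (p.σ + 1) * u 1 x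
          - p.γ * u 2 x)
        = z * u 1 x ∧
      p.μ₃ * v 2 x + δ * (u 0 x - u 2 x) = z * u 2 x

/-- `z` is an eigenvalue of the linearized problem. -/
def IsEigenvalue {n : ℕ} (Ω : Set (E n)) (p : Params) (δ : ℝ) (z : ℂ) : Prop :=
  ∃ u, IsEigenfunction Ω p δ z u

/-- `ev ρ 0 δ, ev ρ 1 δ, ev ρ 2 δ` are the three eigenvalues `β_{k1}, β_{k2}, β_{k3}` of `M_k`
at `ρ = ρ_k`, with algebraic multiplicity, for every mode and every `δ > 0`. -/
def IsLabelling {n : ℕ} (Ω : Set (E n)) (p : Params) (ev : ℝ → Fin 3 → ℝ → ℂ) : Prop :=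
  ∀ ρ ∈ neumannSpectrum Ω, ∀ δ : ℝ, 0 < δ →
    ((p.M ρ δ).map (algebraMap ℝ ℂ)).charpoly
      = ∏ j, (Polynomial.X - Polynomial.C (ev ρ j δ))

end Params

end BZ

end

/-!
The statement splits into an analytic and an algebraic half.

*Reduction to modes.* On a bounded connected open set without any boundary regularity the Neumann
Laplacian need not have a complete system of eigenfunctions, so solutions of the system are not
expanded in modes. Instead, the system is written `Δu = B u` with a constant matrix `B`. By
Cayley–Hamilton a product of factors `B - r` annihilates `u`; the last nonvanishing partial product
`T u` satisfies `Δ(T u) = T B u = B T u = l T u`, so its components are Neumann eigenfunctions and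
its values are eigenvectors of `B` (`exists_mode`). Green's formula tested with the conjugate shows
that `l = -ρ` with `ρ ≥ 0` (`eigenvalue_real`), and then `z` is an eigenvalue of `M ρ δ`
(`Params.isEigenvalue_iff`). For `ρ = 0` Green's formula makes the weak gradient vanish, and
mollification shows that the eigenfunction is constant (`ae_const_of_weak_gradient_zero`).

*Algebra.* The characteristic polynomial of `M ρ δ` is a real cubic `z³ + P₂ z² + P₁ z + P₀` with
`P₂ > 0`, and its stability is decided by the signs of `P₀` and of the Routh–Hurwitz determinant
`H = P₂ P₁ - P₀`. The constant coefficient `P₀` is strictly increasing in `δ`, and the definition of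
`δ₁` says that `P₀ ≥ 0` at `δ = δ₁` for all `ρ ≠ 0`, with equality exactly at the critical modes
(`Params.coeff₀_eq_critExpr`). The number `δ₀` is the positive root of `H` for `ρ = 0`, and
`H > 0` for `ρ ≠ 0` and `δ ≥ δ₀` (`Params.hurwitz_pos`). Hence the first loss of stability is
a real eigenvalue through `0` at a critical mode if `δ₀ < δ₁`, and a conjugate pair of the mode
`ρ = 0` through the imaginary axis if `δ₁ < δ₀`.

The eigenvalues are numbered by the largest real root when `ρ ≠ 0` and by the smallest one when
`ρ = 0` (`Params.label`); the two others are given by the quadratic formula. An extreme real root is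
continuous where it is simple (`continuousAt_topRoot`).
-/

noncomputable section

namespace BZ

/-! ### Real monic cubics -/

/-- The monic cubic `x³ + A x² + B x + C`. -/
def cubic {R : Type*} [CommRing R] (A B C x : R) : R := x ^ 3 + A * x ^ 2 + B * x + C

/-- The Routh–Hurwitz criterion for cubics. -/
lemma re_neg_of_cubic_eq_zero {A B C : ℝ} (hA : 0 < A) (hC : 0 < C) (hH : C < A * B) {z : ℂ}
    (hz : cubic (A : ℂ) B C z = 0) : z.re < 0 := by
  have hB : 0 < B := by
    by_contra! h
    nlinarith
  obtain ⟨x, y⟩ := z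
  have h1 := congrArg Complex.re hz
  have h2 := congrArg Complex.im hz
  simp [cubic, pow_succ] at h1 h2
  by_contra! hx
  simp only at hx
  by_cases hy : y = 0
  · subst hy
    have : 0 < x * x * x + A * (x * x) + B * x + C := by positivity
    nlinarith
  -- the imaginary part determines `y²`; inserting it into the real part eliminates `y`
  · have h3 : y ^ 2 = 3 * x ^ 2 + 2 * A * x + B := by
      apply mul_left_cancel₀ hy
      linarith
    have h4 : 8 * x ^ 3 + 8 * A * x ^ 2 + 2 * B * x + 2 * A ^ 2 * x + (A * B - C) = 0 := by
      linear_combination (-1) * h1 - (3 * x + A) * h3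
    have : 0 ≤ 8 * x ^ 3 + 8 * A * x ^ 2 + 2 * B * x + 2 * A ^ 2 * x := by positivity
    linarith

lemma continuous_cubic (A B C : ℝ) : Continuous (cubic A B C) := by
  unfold cubic; fun_prop

lemma cubic_pos_of_large {A B C x : ℝ} (hx : 1 + |A| + |B| + |C| ≤ x) : 0 < cubic A B C x := by
  unfold cubic
  have hA := abs_nonneg A
  have hB := abs_nonneg B
  have hC := abs_nonneg C
  have hA' := neg_abs_le A
  have hB' := neg_abs_le B
  have hC' := neg_abs_le C
  have hx1 : 1 ≤ x := by linarith
  have h2 : x ≤ x ^ 2 := by nlinarith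
  have e1 : -(|A| * x ^ 2) ≤ A * x ^ 2 := by nlinarith [sq_nonneg x]
  have e2 : -(|B| * x ^ 2) ≤ B * x := by nlinarith
  have e3 : -(|C| * x ^ 2) ≤ C := by nlinarith
  have e4 : 0 ≤ (x - (1 + |A| + |B| + |C|)) * x ^ 2 := by
    apply mul_nonneg <;> nlinarith
  nlinarith

lemma exists_cubic_root_gt {A B C y : ℝ} (hy : cubic A B C y < 0) :
    ∃ x, y < x ∧ cubic A B C x = 0 := by
  set N := max y (1 + |A| + |B| + |C|)
  have hN : 0 < cubic A B C N := cubic_pos_of_large (le_max_right _ _)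
  obtain ⟨x, hx, hx0⟩ := intermediate_value_Icc (le_max_left y (1 + |A| + |B| + |C|))
    (continuous_cubic A B C).continuousOn ⟨hy.le, hN.le⟩
  refine ⟨x, lt_of_le_of_ne hx.1 ?_, hx0⟩
  rintro rfl
  exact hy.ne hx0

/-- The largest real root of a monic cubic. -/
def topRoot (A B C : ℝ) : ℝ := sSup {x | cubic A B C x = 0}

lemma isGreatest_topRoot (A B C : ℝ) : IsGreatest {x | cubic A B C x = 0} (topRoot A B C) := by
  have hne : {x | cubic A B C x = 0}.Nonempty := by
    have : cubic A B C (-(1 + |A| + |B| + |C|)) < 0 := by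
      have := cubic_pos_of_large (A := -A) (B := B) (C := -C) (x := 1 + |A| + |B| + |C|) (by simp)
      unfold cubic at this ⊢
      linarith
    obtain ⟨x, -, hx⟩ := exists_cubic_root_gt this
    exact ⟨x, hx⟩
  have hbdd : BddAbove {x | cubic A B C x = 0} := by
    refine ⟨1 + |A| + |B| + |C|, fun x hx => ?_⟩
    by_contra! h
    exact (cubic_pos_of_large h.le).ne' hx
  have hcl : IsClosed {x | cubic A B C x = 0} :=
    isClosed_eq (continuous_cubic A B C) continuous_const
  exact ⟨hcl.csSup_mem hne hbdd, fun x hx => le_csSup hbdd hx⟩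

lemma cubic_topRoot (A B C : ℝ) : cubic A B C (topRoot A B C) = 0 := (isGreatest_topRoot A B C).1

lemma le_topRoot {A B C x : ℝ} (h : cubic A B C x = 0) : x ≤ topRoot A B C :=
  (isGreatest_topRoot A B C).2 h

lemma lt_topRoot {A B C x : ℝ} (h : cubic A B C x < 0) : x < topRoot A B C := by
  obtain ⟨y, hy, hy0⟩ := exists_cubic_root_gt h
  exact hy.trans_le (le_topRoot hy0)

/-- The derivative of `cubic A B C`. -/
def cubicDeriv (A B x : ℝ) : ℝ := 3 * x ^ 2 + 2 * A * x + B

lemma topRoot_lt {A B C x : ℝ} (h0 : 0 < cubic A B C x) (h1 : 0 < cubicDeriv A B x)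
    (h2 : 0 < 3 * x + A) : topRoot A B C < x := by
  by_contra! h
  obtain ⟨k, hk, hk'⟩ : ∃ k, 0 ≤ k ∧ topRoot A B C = x + k :=
    ⟨topRoot A B C - x, by linarith, by ring⟩
  have h3 := cubic_topRoot A B C
  -- Taylor expansion at `x`; all coefficients are nonnegative
  have h4 : cubic A B C (x + k)
      = cubic A B C x + cubicDeriv A B x * k + (3 * x + A) * k ^ 2 + k ^ 3 := by
    unfold cubic cubicDeriv; ring
  rw [hk', h4] at h3
  have : 0 ≤ cubicDeriv A B x * k + (3 * x + A) * k ^ 2 + k ^ 3 := by positivity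
  linarith

/-- The largest real root depends continuously on the coefficients where it is a simple root to
the right of the inflection point. -/
lemma continuousAt_topRoot {A B C : ℝ → ℝ} (hA : Continuous A) (hB : Continuous B)
    (hC : Continuous C) {t : ℝ} (h1 : 0 < cubicDeriv (A t) (B t) (topRoot (A t) (B t) (C t)))
    (h2 : 0 < 3 * topRoot (A t) (B t) (C t) + A t) :
    ContinuousAt (fun s => topRoot (A s) (B s) (C s)) t := by
  set r := topRoot (A t) (B t) (C t) with hr
  have h0 : cubic (A t) (B t) (C t) r = 0 := cubic_topRoot _ _ _
  have hev : ∀ᶠ k in nhdsWithin (0 : ℝ) (Ioi 0),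
      0 < cubicDeriv (A t) (B t) (r + k) ∧ 0 < cubic (A t) (B t) (C t) (r + k) ∧
        cubic (A t) (B t) (C t) (r - k) < 0 := by
    have e0 : ∀ᶠ k in nhdsWithin (0 : ℝ) (Ioi 0), 0 < cubicDeriv (A t) (B t) (r + k) := by
      have : ContinuousAt (fun k => cubicDeriv (A t) (B t) (r + k)) 0 := by
        unfold cubicDeriv; fun_prop
      exact (this.eventually (lt_mem_nhds (by simpa using h1))).filter_mono nhdsWithin_le_nhds
    have e1 : ∀ᶠ k in nhdsWithin (0 : ℝ) (Ioi 0),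
        0 < cubicDeriv (A t) (B t) r + (3 * r + A t) * k + k ^ 2 := by
      have : ContinuousAt (fun k => cubicDeriv (A t) (B t) r + (3 * r + A t) * k + k ^ 2) 0 := by
        fun_prop
      exact (this.eventually (lt_mem_nhds (by simpa using h1))).filter_mono nhdsWithin_le_nhds
    have e2 : ∀ᶠ k in nhdsWithin (0 : ℝ) (Ioi 0),
        0 < cubicDeriv (A t) (B t) r - (3 * r + A t) * k + k ^ 2 := by
      have : ContinuousAt (fun k => cubicDeriv (A t) (B t) r - (3 * r + A t) * k + k ^ 2) 0 := by
        fun_prop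
      exact (this.eventually (lt_mem_nhds (by simpa using h1))).filter_mono nhdsWithin_le_nhds
    filter_upwards [e0, e1, e2, self_mem_nhdsWithin] with k k0 k1 k2 (hk : 0 < k)
    refine ⟨k0, ?_, ?_⟩
    · have : cubic (A t) (B t) (C t) (r + k)
          = k * (cubicDeriv (A t) (B t) r + (3 * r + A t) * k + k ^ 2) := by
        rw [← sub_zero (cubic (A t) (B t) (C t) (r + k)), ← h0]; unfold cubic cubicDeriv; ring
      rw [this]; positivity
    · have : cubic (A t) (B t) (C t) (r - k)
          = -(k * (cubicDeriv (A t) (B t) r - (3 * r + A t) * k + k ^ 2)) := by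
        rw [← sub_zero (cubic (A t) (B t) (C t) (r - k)), ← h0]; unfold cubic cubicDeriv; ring
      rw [this]
      have : 0 < k * (cubicDeriv (A t) (B t) r - (3 * r + A t) * k + k ^ 2) := by positivity
      linarith
  rw [Metric.continuousAt_iff']
  intro e he
  have hlt : ∀ᶠ k in nhdsWithin (0 : ℝ) (Ioi 0), k < e :=
    (gt_mem_nhds he : ∀ᶠ k in nhds (0 : ℝ), k < e).filter_mono nhdsWithin_le_nhds
  obtain ⟨k, ⟨hk1, hk2, hk3⟩, hke, hk : 0 < k⟩ := (hev.and (hlt.and self_mem_nhdsWithin)).exists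
  have c1 : ∀ᶠ s in nhds t, 0 < cubicDeriv (A s) (B s) (r + k) := by
    have : Continuous (fun s => cubicDeriv (A s) (B s) (r + k)) := by unfold cubicDeriv; fun_prop
    exact this.continuousAt.eventually (lt_mem_nhds hk1)
  have c2 : ∀ᶠ s in nhds t, 0 < cubic (A s) (B s) (C s) (r + k) := by
    have : Continuous (fun s => cubic (A s) (B s) (C s) (r + k)) := by unfold cubic; fun_prop
    exact this.continuousAt.eventually (lt_mem_nhds hk2)
  have c3 : ∀ᶠ s in nhds t, cubic (A s) (B s) (C s) (r - k) < 0 := by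
    have : Continuous (fun s => cubic (A s) (B s) (C s) (r - k)) := by unfold cubic; fun_prop
    exact this.continuousAt.eventually (gt_mem_nhds hk3)
  have c4 : ∀ᶠ s in nhds t, 0 < 3 * (r + k) + A s := by
    have : Continuous (fun s => 3 * (r + k) + A s) := by fun_prop
    exact this.continuousAt.eventually (lt_mem_nhds (by linarith))
  filter_upwards [c1, c2, c3, c4] with s s1 s2 s3 s4
  have u1 := topRoot_lt s2 s1 s4
  have u2 := lt_topRoot s3
  rw [Real.dist_eq, abs_lt]
  constructor <;> linarith

/-- Simplicity of the largest root and its position relative to the inflection point persist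
under small perturbations, so that it is continuous near such a parameter. -/
lemma eventually_continuousAt_topRoot {A B C : ℝ → ℝ} (hA : Continuous A) (hB : Continuous B)
    (hC : Continuous C) {t : ℝ} (h1 : 0 < cubicDeriv (A t) (B t) (topRoot (A t) (B t) (C t)))
    (h2 : 0 < 3 * topRoot (A t) (B t) (C t) + A t) :
    ∀ᶠ s in nhds t, ContinuousAt (fun s => topRoot (A s) (B s) (C s)) s ∧
      0 < cubicDeriv (A s) (B s) (topRoot (A s) (B s) (C s)) := by
  have h := continuousAt_topRoot hA hB hC h1 h2
  have hA' := hA.continuousAt (x := t)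
  have hB' := hB.continuousAt (x := t)
  have e1 : ∀ᶠ s in nhds t, 0 < cubicDeriv (A s) (B s) (topRoot (A s) (B s) (C s)) := by
    have : ContinuousAt (fun s => cubicDeriv (A s) (B s) (topRoot (A s) (B s) (C s))) t := by
      unfold cubicDeriv
      exact (((continuousAt_const.mul (h.pow 2))).add ((continuousAt_const.mul hA').mul h)).add hB'
    exact this.eventually (lt_mem_nhds h1)
  have e2 : ∀ᶠ s in nhds t, 0 < 3 * topRoot (A s) (B s) (C s) + A s :=
    ((continuousAt_const.mul h).add hA').eventually (lt_mem_nhds h2)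
  filter_upwards [e1, e2] with s s1 s2
  exact ⟨continuousAt_topRoot hA hB hC s1 s2, s1⟩

/-- The smallest real root of a monic cubic. -/
def botRoot (A B C : ℝ) : ℝ := -topRoot (-A) B (-C)

lemma cubic_botRoot (A B C : ℝ) : cubic A B C (botRoot A B C) = 0 := by
  have := cubic_topRoot (-A) B (-C)
  unfold botRoot
  generalize topRoot (-A) B (-C) = r at *
  unfold cubic at *
  linear_combination -this

lemma botRoot_neg {A B C : ℝ} (hC : 0 < C) : botRoot A B C < 0 := by
  have := lt_topRoot (A := -A) (B := B) (C := -C) (x := 0) (by simpa [cubic] using hC)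
  unfold botRoot
  linarith

/-! ### Roots of a real quadratic -/

/-- A root of `x² - s x + q`: the larger one if the roots are real, the one in the upper half
plane otherwise. One of the two square roots always vanishes. -/
def quadHi (s q : ℝ) : ℂ := ⟨(s + √(s ^ 2 - 4 * q)) / 2, √(4 * q - s ^ 2) / 2⟩

/-- The root of `x² - s x + q` other than `quadHi s q`. -/
def quadLo (s q : ℝ) : ℂ := ⟨(s - √(s ^ 2 - 4 * q)) / 2, -(√(4 * q - s ^ 2) / 2)⟩

lemma quadHi_add_quadLo (s q : ℝ) : quadHi s q + quadLo s q = s := by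
  apply Complex.ext <;> simp [quadHi, quadLo]
  ring

lemma quadHi_mul_quadLo (s q : ℝ) : quadHi s q * quadLo s q = q := by
  rcases le_total (s ^ 2) (4 * q) with h | h
  · have h0 : √(s ^ 2 - 4 * q) = 0 := Real.sqrt_eq_zero_of_nonpos (by linarith)
    have h1 := Real.mul_self_sqrt (sub_nonneg.2 h)
    apply Complex.ext <;> simp [quadHi, quadLo, h0] <;> nlinarith
  · have h0 : √(4 * q - s ^ 2) = 0 := Real.sqrt_eq_zero_of_nonpos (by linarith)
    have h1 := Real.mul_self_sqrt (sub_nonneg.2 h)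
    apply Complex.ext <;> simp [quadHi, quadLo, h0]
    nlinarith

lemma quad_re_pos {s q : ℝ} (hs : 0 < s) (hq : 0 < q) :
    0 < (quadHi s q).re ∧ 0 < (quadLo s q).re := by
  have h1 := Real.sqrt_nonneg (s ^ 2 - 4 * q)
  have h2 : √(s ^ 2 - 4 * q) < s := (Real.sqrt_lt' hs).2 (by linarith)
  constructor <;> simp only [quadHi, quadLo] <;> linarith

lemma quad_re_neg {s q : ℝ} (hs : s < 0) (hq : 0 < q) :
    (quadHi s q).re < 0 ∧ (quadLo s q).re < 0 := by
  have h1 := Real.sqrt_nonneg (s ^ 2 - 4 * q)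
  have h2 : √(s ^ 2 - 4 * q) < -s := (Real.sqrt_lt' (by linarith)).2 (by nlinarith)
  constructor <;> simp only [quadHi, quadLo] <;> linarith

lemma quad_re_eq_zero {q : ℝ} (hq : 0 < q) : (quadHi 0 q).re = 0 ∧ (quadLo 0 q).re = 0 := by
  have h0 : √((0 : ℝ) ^ 2 - 4 * q) = 0 := Real.sqrt_eq_zero_of_nonpos (by linarith)
  constructor <;> simp only [quadHi, quadLo, h0] <;> norm_num

lemma quadHi_nonreal {s q : ℝ} (h : s ^ 2 < 4 * q) :
    (quadHi s q).im ≠ 0 ∧ quadHi s q = (starRingEnd ℂ) (quadLo s q) := by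
  have h0 : √(s ^ 2 - 4 * q) = 0 := Real.sqrt_eq_zero_of_nonpos (by linarith)
  have h1 : 0 < √(4 * q - s ^ 2) := Real.sqrt_pos.2 (by linarith)
  constructor
  · simp only [quadHi]; positivity
  · apply Complex.ext <;> simp [quadHi, quadLo, h0]

/-- The sum of the two roots of a cubic other than `r`. -/
def cosum (A r : ℝ) : ℝ := -A - r

/-- The product of the two roots of a cubic other than `r`. -/
def coprod (A B r : ℝ) : ℝ := B + A * r + r ^ 2

lemma cubic_factor {A B C r : ℝ} (hr : cubic A B C r = 0) (z : ℂ) :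
    cubic (A : ℂ) B C z = (z - r) * (z - quadHi (cosum A r) (coprod A B r)) *
      (z - quadLo (cosum A r) (coprod A B r)) := by
  have h1 := quadHi_add_quadLo (cosum A r) (coprod A B r)
  have h2 := quadHi_mul_quadLo (cosum A r) (coprod A B r)
  have h3 : cubic (A : ℂ) B C r = 0 := by
    unfold cubic at *; exact_mod_cast hr
  generalize quadHi (cosum A r) (coprod A B r) = u at *
  generalize quadLo (cosum A r) (coprod A B r) = v at *
  unfold cosum at h1
  unfold coprod at h2
  push_cast at h1 h2
  unfold cubic at *
  linear_combination h3 + (z - r) * z * h1 - (z - r) * h2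

/-- A root with positive derivative is different from the two other roots. -/
lemma ne_of_cubicDeriv_pos {A B r : ℝ} (h : 0 < cubicDeriv A B r) :
    quadHi (cosum A r) (coprod A B r) ≠ r ∧ quadLo (cosum A r) (coprod A B r) ≠ r := by
  have h1 := quadHi_add_quadLo (cosum A r) (coprod A B r)
  have h2 := quadHi_mul_quadLo (cosum A r) (coprod A B r)
  generalize quadHi (cosum A r) (coprod A B r) = u at *
  generalize quadLo (cosum A r) (coprod A B r) = v at *
  have h3 : ((cubicDeriv A B r : ℝ) : ℂ) = (r - u) * (r - v) := by
    unfold cosum at h1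
    unfold coprod at h2
    unfold cubicDeriv
    push_cast at *
    linear_combination -h2 + r * h1
  have h4 : ((cubicDeriv A B r : ℝ) : ℂ) ≠ 0 := by exact_mod_cast h.ne'
  constructor
  · rintro rfl; simp [h3] at h4
  · rintro rfl; simp [h3] at h4

/-- If `C > 0` but the Routh–Hurwitz determinant `A B - C` is negative, then the two roots
other than a negative root `r` have positive sum and product. -/
lemma cosum_pos_of_unstable {A B C r : ℝ} (hC : 0 < C) (hH : A * B < C)
    (hr : cubic A B C r = 0) (hr0 : r < 0) : 0 < cosum A r ∧ 0 < coprod A B r := by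
  have hq : 0 < coprod A B r := by
    have : -r * coprod A B r = C := by
      unfold cubic at hr; unfold coprod; linear_combination -hr
    exact pos_of_mul_pos_right (by rw [this]; exact hC) (by linarith : 0 ≤ -r)
  refine ⟨?_, hq⟩
  by_contra! hs
  have h1 : C - A * B = cosum A r * (r ^ 2 + r * cosum A r + coprod A B r) := by
    unfold cubic at hr; unfold cosum coprod; linear_combination hr
  have h2 : 0 ≤ r ^ 2 + r * cosum A r + coprod A B r := by
    have := mul_nonneg_of_nonpos_of_nonpos hr0.le hs
    positivity
  nlinarith

namespace Params

variable (p : Params)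

/-! ### The parameters and the characteristic polynomials -/

lemma σ_pos : 0 < p.σ := by
  have hβ := p.β_pos
  have hγ := p.γ_pos
  unfold σ
  have : |1 - p.γ - p.β| < √((1 - p.γ - p.β) ^ 2 + 4 * p.β * (1 + p.γ)) := by
    rw [← Real.sqrt_sq_eq_abs]
    apply Real.sqrt_lt_sqrt (sq_nonneg _)
    have : 0 < 4 * p.β * (1 + p.γ) := by positivity
    linarith
  have h2 := neg_abs_le (1 - p.γ - p.β)
  have : 0 < (1 - p.γ - p.β) + √((1 - p.γ - p.β) ^ 2 + 4 * p.β * (1 + p.γ)) := by linarith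
  positivity

lemma two_β_σ : 2 * p.β * p.σ + p.β + p.γ - 1 =
    √((1 - p.γ - p.β) ^ 2 + 4 * p.β * (1 + p.γ)) := by
  have hβ := p.β_pos
  unfold σ
  field_simp
  ring

/-- `σ` solves the steady state equation. -/
lemma σ_eq : p.β * p.σ ^ 2 + (p.γ + p.β - 1) * p.σ - (1 + p.γ) = 0 := by
  have hβ := p.β_pos
  have hγ := p.γ_pos
  have h := Real.sq_sqrt (by positivity : 0 ≤ (1 - p.γ - p.β) ^ 2 + 4 * p.β * (1 + p.γ))
  rw [← two_β_σ] at h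
  apply mul_left_cancel₀ (by positivity : 4 * p.β ≠ 0)
  linear_combination h

lemma c_pos : 0 < p.c := by
  have hβ := p.β_pos
  have hγ := p.γ_pos
  unfold c
  rw [two_β_σ]
  exact mul_pos p.σ_pos (Real.sqrt_pos.2 (by positivity))

/-- Minus the first diagonal entry of the reaction matrix. -/
def A₁ : ℝ := p.α / 2 * (3 * p.β * p.σ + p.γ - 1)

/-- Minus the second diagonal entry of the reaction matrix. -/
def A₂ : ℝ := (p.σ + 1) / p.α

lemma A₁_pos : 0 < p.A₁ := by
  have hβ := p.β_pos
  have hγ := p.γ_pos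
  have hα := p.α_pos
  have hσ := p.σ_pos
  have h := p.σ_eq
  -- by `σ_eq`, the product is `2 (1 + γ + σ (1 - γ)) + 2γ`, and `1 + γ + σ (1 - γ) = β (σ² + σ)`
  have h1 : 0 < (3 * p.β * p.σ + p.γ - 1) * (1 + p.σ) := by
    have : 0 < p.β * (p.σ ^ 2 + p.σ) := by positivity
    nlinarith
  have h2 : 0 < 3 * p.β * p.σ + p.γ - 1 := pos_of_mul_pos_left h1 (by positivity)
  unfold A₁; positivity

lemma A₂_pos : 0 < p.A₂ := by
  have hα := p.α_pos
  have hσ := p.σ_pos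
  unfold A₂; positivity

lemma a_eq : p.a = p.A₁ + p.A₂ := by
  unfold a A₁ A₂; ring

lemma a_pos : 0 < p.a := by
  rw [a_eq]; exact add_pos p.A₁_pos p.A₂_pos

lemma A₁_mul_A₂ : p.A₁ * p.A₂ = (3 * p.β * p.σ + p.γ - 1) * (p.σ + 1) / 2 := by
  have hα := p.α_pos
  unfold A₁ A₂; field_simp

lemma b_eq : p.b = (p.σ - 1) * (1 + p.γ - p.β * p.σ) / 2 - p.A₁ * p.A₂ := by
  rw [A₁_mul_A₂]; unfold b; ring

lemma b_add_c : p.b + p.c = p.γ * (p.σ - 1) := by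
  unfold b c; ring

/-- If `b < 0`, the linear coefficient of `δ ↦ hurwitz 0 δ` is positive. -/
lemma lt_sq_a_of_b_neg (hb : p.b < 0) : p.b + p.c < p.a ^ 2 := by
  have hγ := p.γ_pos
  have hσ := p.σ_pos
  have ha := p.a_pos
  rw [b_add_c]
  rcases le_or_gt p.σ 1 with h | h
  · nlinarith [sq_pos_of_pos ha]
  -- `a² ≥ 4 A₁ A₂ > 2 (σ - 1) (1 + γ - βσ)`, and `1 + γ - βσ = 2γσ / (1 + σ) ≥ γ` for `σ ≥ 1`
  · have h1 : 4 * (p.A₁ * p.A₂) ≤ p.a ^ 2 := by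
      rw [a_eq]; nlinarith [sq_nonneg (p.A₁ - p.A₂)]
    rw [b_eq] at hb
    have h2 : (1 + p.γ - p.β * p.σ) * (1 + p.σ) = 2 * p.γ * p.σ := by
      linear_combination -p.σ_eq
    have h3 : p.γ ≤ 1 + p.γ - p.β * p.σ := by
      by_contra! h3
      nlinarith
    nlinarith

/-- `Q(ρ) = (μ₁ ρ + A₁) (μ₂ ρ + A₂) - A₁ A₂`, the denominator in `critExpr`. -/
def Q (ρ : ℝ) : ℝ := (p.A₂ * p.μ₁ + p.A₁ * p.μ₂) * ρ + p.μ₁ * p.μ₂ * ρ ^ 2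

lemma Q_nonneg {ρ : ℝ} (hρ : 0 ≤ ρ) : 0 ≤ p.Q ρ := by
  have := p.A₁_pos; have := p.A₂_pos; have := p.μ₁_pos; have := p.μ₂_pos
  unfold Q; positivity

lemma Q_pos {ρ : ℝ} (hρ : 0 < ρ) : 0 < p.Q ρ := by
  have := p.A₁_pos; have := p.A₂_pos; have := p.μ₁_pos; have := p.μ₂_pos
  unfold Q; positivity

/-- The coefficient of `z²` in the characteristic polynomial of `M ρ δ`. -/
def coeff₂ (ρ δ : ℝ) : ℝ := p.a + (p.μ₁ + p.μ₂) * ρ + (p.μ₃ * ρ + δ)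

/-- The coefficient of `z` in the characteristic polynomial of `M ρ δ`. -/
def coeff₁ (ρ δ : ℝ) : ℝ := p.Q ρ - p.b + (p.μ₃ * ρ + δ) * (p.a + (p.μ₁ + p.μ₂) * ρ)

/-- The constant coefficient of the characteristic polynomial of `M ρ δ`. -/
def coeff₀ (ρ δ : ℝ) : ℝ := p.μ₃ * ρ * (p.Q ρ - p.b) + δ * (p.Q ρ + p.c)

lemma continuous_coeff₂ (ρ : ℝ) : Continuous (p.coeff₂ ρ) := by unfold coeff₂; fun_prop
lemma continuous_coeff₁ (ρ : ℝ) : Continuous (p.coeff₁ ρ) := by unfold coeff₁; fun_prop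
lemma continuous_coeff₀ (ρ : ℝ) : Continuous (p.coeff₀ ρ) := by unfold coeff₀; fun_prop

lemma eval_charpoly (ρ δ : ℝ) (z : ℂ) :
    (((p.M ρ δ).map (algebraMap ℝ ℂ)).charpoly).eval z
      = cubic (p.coeff₂ ρ δ : ℂ) (p.coeff₁ ρ δ) (p.coeff₀ ρ δ) z := by
  have hα : (p.α : ℂ) ≠ 0 := by exact_mod_cast p.α_pos.ne'
  rw [Matrix.eval_charpoly, Matrix.det_fin_three]
  simp [M, cubic, coeff₂, coeff₁, coeff₀, Q, a, b, c, A₁, A₂, Matrix.scalar_apply]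
  field_simp
  ring

lemma charpoly_eq {ρ δ : ℝ} {x y z : ℂ} (h : ∀ w : ℂ,
      cubic (p.coeff₂ ρ δ : ℂ) (p.coeff₁ ρ δ) (p.coeff₀ ρ δ) w = (w - x) * (w - y) * (w - z)) :
    ((p.M ρ δ).map (algebraMap ℝ ℂ)).charpoly
      = (Polynomial.X - Polynomial.C x) * (Polynomial.X - Polynomial.C y)
        * (Polynomial.X - Polynomial.C z) := by
  apply Polynomial.funext
  intro w
  rw [eval_charpoly, h]
  simp

lemma coeff₂_pos {ρ δ : ℝ} (hρ : 0 ≤ ρ) (hδ : 0 < δ) : 0 < p.coeff₂ ρ δ := by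
  have := p.μ₁_pos; have := p.μ₂_pos; have := p.μ₃_pos; have := p.a_pos
  unfold coeff₂; positivity

lemma coeff₀_lt {ρ δ δ' : ℝ} (hρ : 0 ≤ ρ) (h : δ < δ') : p.coeff₀ ρ δ < p.coeff₀ ρ δ' := by
  have := p.Q_nonneg hρ; have := p.c_pos
  unfold coeff₀; nlinarith

/-- The comparison of `critExpr` with its own value of `δ` is governed by the sign of the constant
coefficient of the characteristic polynomial. -/
lemma coeff₀_eq_critExpr {ρ : ℝ} (hρ : 0 < ρ) (δ : ℝ) :
    p.coeff₀ ρ δ = p.Q ρ * (δ - p.critExpr δ ρ) := by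
  have hQ := (p.Q_pos hρ).ne'
  have : p.critExpr δ ρ = (p.μ₃ * ρ * p.b - p.C δ) / p.Q ρ - p.μ₃ * ρ := rfl
  rw [this]
  have hC : p.C δ = δ * p.c := by unfold C c; ring
  rw [hC]
  unfold coeff₀
  field_simp
  ring

/-- The Routh–Hurwitz determinant of the characteristic polynomial of `M ρ δ`. -/
def hurwitz (ρ δ : ℝ) : ℝ := p.coeff₂ ρ δ * p.coeff₁ ρ δ - p.coeff₀ ρ δ

/-- The Routh–Hurwitz determinant at the mode `ρ = 0`. -/
lemma hurwitz_zero (δ : ℝ) :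
    p.hurwitz 0 δ = p.a * δ ^ 2 + (p.a ^ 2 - p.b - p.c) * δ - p.a * p.b := by
  unfold hurwitz coeff₂ coeff₁ coeff₀ Q; ring

lemma hurwitz_eq (ρ δ : ℝ) : p.hurwitz ρ δ = (p.a + (p.μ₁ + p.μ₂) * ρ) *
    (p.Q ρ - p.b + (p.a + (p.μ₁ + p.μ₂) * ρ + (p.μ₃ * ρ + δ)) * (p.μ₃ * ρ + δ))
      - δ * (p.b + p.c) := by
  unfold hurwitz coeff₂ coeff₁ coeff₀; ring

/-- The mode `ρ = 0` has the smallest Routh–Hurwitz determinant. -/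
lemma hurwitz_zero_lt {ρ δ : ℝ} (hρ : 0 < ρ) (hδ : 0 < δ) (h : 0 < -p.b + (p.a + δ) * δ) :
    p.hurwitz 0 δ < p.hurwitz ρ δ := by
  have h1 := p.μ₁_pos
  have h2 := p.μ₂_pos
  have h3 := p.μ₃_pos
  have ha := p.a_pos
  have hQ := p.Q_pos hρ
  have hQ0 : p.Q 0 = 0 := by unfold Q; ring
  rw [hurwitz_eq, hurwitz_eq, hQ0]
  have hs : 0 < (p.μ₁ + p.μ₂) * ρ := by positivity
  have ht : 0 < p.μ₃ * ρ := by positivity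
  generalize (p.μ₁ + p.μ₂) * ρ = s at *
  generalize p.μ₃ * ρ = t at *
  have e : -p.b + (p.a + δ) * δ < p.Q ρ - p.b + (p.a + s + (t + δ)) * (t + δ) := by
    have : (p.a + δ) * δ ≤ (p.a + s + (t + δ)) * (t + δ) := by
      apply mul_le_mul <;> first | positivity | linarith
    linarith
  have e2 : p.a * (-p.b + (p.a + δ) * δ) <
      (p.a + s) * (p.Q ρ - p.b + (p.a + s + (t + δ)) * (t + δ)) := by
    apply mul_lt_mul <;> linarith
  simp only [mul_zero, add_zero, zero_add, zero_sub]
  linarith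

/-- `δ₀` is the positive root of the quadratic polynomial `δ ↦ hurwitz 0 δ`. -/
lemma δ₀_spec (hb : 0 < p.b) : 0 < p.δ₀ ∧ p.hurwitz 0 p.δ₀ = 0 := by
  have ha := p.a_pos
  have hd : 0 < 4 * p.a ^ 2 * p.b := by positivity
  have hs := Real.sq_sqrt (by positivity : 0 ≤ (p.c + p.b - p.a ^ 2) ^ 2 + 4 * p.a ^ 2 * p.b)
  have hδ : 2 * p.a * p.δ₀ = p.c + p.b - p.a ^ 2
      + √((p.c + p.b - p.a ^ 2) ^ 2 + 4 * p.a ^ 2 * p.b) := by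
    unfold δ₀; field_simp
  constructor
  · have : |p.c + p.b - p.a ^ 2| < √((p.c + p.b - p.a ^ 2) ^ 2 + 4 * p.a ^ 2 * p.b) := by
      rw [← Real.sqrt_sq_eq_abs]
      exact Real.sqrt_lt_sqrt (sq_nonneg _) (by linarith)
    have h2 := neg_abs_le (p.c + p.b - p.a ^ 2)
    have h3 : 0 < 2 * p.a * p.δ₀ := by linarith
    exact pos_of_mul_pos_right h3 (by positivity)
  · rw [hurwitz_zero]
    apply mul_left_cancel₀ (by positivity : 4 * p.a ≠ 0)
    rw [← sub_eq_iff_eq_add'.2 hδ] at hs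
    linear_combination hs

lemma hurwitz_zero_eq (hb : 0 < p.b) (δ : ℝ) :
    p.hurwitz 0 δ = p.a * (δ - p.δ₀) * (δ + p.b / p.δ₀) := by
  obtain ⟨h0, h1⟩ := p.δ₀_spec hb
  rw [hurwitz_zero] at *
  field_simp
  linear_combination δ * h1

lemma hurwitz_zero_pos (hb : 0 < p.b) {δ : ℝ} (h : p.δ₀ < δ) : 0 < p.hurwitz 0 δ := by
  obtain ⟨h0, -⟩ := p.δ₀_spec hb
  have := p.a_pos
  have : 0 < δ := h0.trans h
  rw [hurwitz_zero_eq p hb]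
  have : 0 < δ - p.δ₀ := by linarith
  positivity

lemma hurwitz_zero_neg (hb : 0 < p.b) {δ : ℝ} (hδ : 0 < δ) (h : δ < p.δ₀) :
    p.hurwitz 0 δ < 0 := by
  obtain ⟨h0, -⟩ := p.δ₀_spec hb
  have := p.a_pos
  rw [hurwitz_zero_eq p hb]
  have : 0 < p.δ₀ - δ := by linarith
  have : 0 < p.a * (p.δ₀ - δ) * (δ + p.b / p.δ₀) := by positivity
  nlinarith

/-- From `δ₀` on, the Routh–Hurwitz determinants of all nonzero modes are positive. -/
lemma hurwitz_pos (hb : 0 < p.b) {ρ δ : ℝ} (hρ : 0 < ρ) (h : p.δ₀ ≤ δ) :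
    0 < p.hurwitz ρ δ := by
  obtain ⟨h0, -⟩ := p.δ₀_spec hb
  have hδ : 0 < δ := h0.trans_le h
  have ha := p.a_pos
  have hc := p.c_pos
  have hH : 0 ≤ p.hurwitz 0 δ := by
    rw [hurwitz_zero_eq p hb]
    have : 0 ≤ δ - p.δ₀ := by linarith
    positivity
  refine hH.trans_lt (p.hurwitz_zero_lt hρ hδ ?_)
  have e : p.a * (-p.b + (p.a + δ) * δ) = p.hurwitz 0 δ + δ * (p.b + p.c) := by
    rw [hurwitz_zero]; ring
  have : 0 < p.a * (-p.b + (p.a + δ) * δ) := by rw [e]; positivity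
  exact pos_of_mul_pos_right this ha.le

lemma hurwitz_pos_of_b_neg (hb : p.b < 0) {ρ δ : ℝ} (hρ : 0 ≤ ρ) (hδ : 0 < δ) :
    0 < p.hurwitz ρ δ := by
  have ha := p.a_pos
  have h := p.lt_sq_a_of_b_neg hb
  have h0 : 0 < p.hurwitz 0 δ := by
    rw [hurwitz_zero]
    have h1 : 0 < p.a * δ ^ 2 := by positivity
    have h2 : 0 < (p.a ^ 2 - p.b - p.c) * δ := mul_pos (by linarith) hδ
    nlinarith
  rcases hρ.eq_or_lt with rfl | hρ
  · exact h0
  · refine h0.trans (p.hurwitz_zero_lt hρ hδ ?_)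
    have : 0 < (p.a + δ) * δ := by positivity
    linarith

/-- The Routh–Hurwitz criterion for `M ρ δ`. -/
lemma stable {ρ δ : ℝ} (hρ : 0 ≤ ρ) (hδ : 0 < δ) (h0 : 0 < p.coeff₀ ρ δ)
    (hH : 0 < p.hurwitz ρ δ) {z : ℂ}
    (hz : cubic (p.coeff₂ ρ δ : ℂ) (p.coeff₁ ρ δ) (p.coeff₀ ρ δ) z = 0) : z.re < 0 :=
  re_neg_of_cubic_eq_zero (p.coeff₂_pos hρ hδ) h0 (by unfold hurwitz at hH; linarith) hz

/-- The sum of `coeff₀` and `hurwitz` is the product of `coeff₂` and `coeff₁`. -/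
lemma coeff₁_pos {ρ δ : ℝ} (hρ : 0 ≤ ρ) (hδ : 0 < δ)
    (h : 0 < p.coeff₀ ρ δ + p.hurwitz ρ δ) : 0 < p.coeff₁ ρ δ := by
  have h2 := p.coeff₂_pos hρ hδ
  refine (mul_pos_iff_of_pos_left h2).1 ?_
  unfold hurwitz at h
  linarith

lemma coeff₀_zero (δ : ℝ) : p.coeff₀ 0 δ = δ * p.c := by
  unfold coeff₀ Q; ring

end Params

variable {n : ℕ} {Ω : Set (E n)}

/-! ### Linear structure of the Neumann Laplacian -/

lemma IsTest.continuous {φ : E n → ℝ} (hφ : IsTest Ω φ) : Continuous φ := hφ.1.continuous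

lemma IsTest.continuous_partial {φ : E n → ℝ} (hφ : IsTest Ω φ) (e : E n) :
    Continuous fun x => fderiv ℝ φ x e :=
  (hφ.1.continuous_fderiv (by simp)).clm_apply continuous_const

lemma IsTest.hasCompactSupport_partial {φ : E n → ℝ} (hφ : IsTest Ω φ) (e : E n) :
    HasCompactSupport fun x => fderiv ℝ φ x e :=
  hφ.2.1.fderiv_apply ℝ e

lemma MemL2.integrable_smul {u : E n → ℂ} (hu : MemL2 Ω u) {f : E n → ℝ} (hf : Continuous f)
    (hc : HasCompactSupport f) : Integrable (fun x => f x • u x) (volume.restrict Ω) := by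
  have hf2 : MemLp f 2 (volume.restrict Ω) := hf.memLp_of_hasCompactSupport hc
  exact memLp_one_iff_integrable.1 (MemLp.smul (r := 1) hu hf2)

lemma MemL2.integrable_mul {u v : E n → ℂ} (hu : MemL2 Ω u) (hv : MemL2 Ω v) :
    Integrable (fun x => u x * v x) (volume.restrict Ω) :=
  MemLp.integrable_mul hu hv

lemma MemL2.lin {u v : E n → ℂ} (hu : MemL2 Ω u) (hv : MemL2 Ω v) (k : ℂ) :
    MemL2 Ω (fun x => u x + k * v x) :=
  MemLp.add hu (MemLp.const_mul hv k)

lemma HasWeakPartial.lin {i : Fin n} {u g v h : E n → ℂ} (hu : HasWeakPartial Ω i u g)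
    (hv : HasWeakPartial Ω i v h) (mu : MemL2 Ω u) (mg : MemL2 Ω g) (mv : MemL2 Ω v)
    (mh : MemL2 Ω h) (k : ℂ) :
    HasWeakPartial Ω i (fun x => u x + k * v x) (fun x => g x + k * h x) := by
  intro φ hφ
  have e := hφ.continuous_partial (EuclideanSpace.single i 1)
  have e' := hφ.hasCompactSupport_partial (EuclideanSpace.single i 1)
  have l : ∀ {f : E n → ℝ} {u v : E n → ℂ}, MemL2 Ω u → MemL2 Ω v → Continuous f →
      HasCompactSupport f → ∫ x in Ω, f x • (u x + k * v x)
        = (∫ x in Ω, f x • u x) + k * ∫ x in Ω, f x • v x := by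
    intro f u v hu hv hf hc
    rw [← integral_const_mul, ← integral_add (hu.integrable_smul hf hc)
      ((hv.integrable_smul hf hc).const_mul k)]
    congr 1 with x
    simp only [Complex.real_smul]
    ring
  rw [l mu mv e e', l mg mh hφ.continuous hφ.2.1, hu φ hφ, hv φ hφ]
  ring

lemma IsH1.lin {u v : E n → ℂ} {g h : Fin n → E n → ℂ} (hu : IsH1 Ω u g) (hv : IsH1 Ω v h)
    (k : ℂ) : IsH1 Ω (fun x => u x + k * v x) (fun i x => g i x + k * h i x) :=
  ⟨hu.1.lin hv.1 k, fun i => ⟨(hu.2 i).1.lin (hv.2 i).1 k,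
    (hu.2 i).2.lin (hv.2 i).2 hu.1 (hu.2 i).1 hv.1 (hv.2 i).1 k⟩⟩

lemma isH1_zero : IsH1 Ω (fun _ => 0) (fun _ _ => 0) := by
  refine ⟨MemLp.zero, fun i => ⟨MemLp.zero, fun φ _ => ?_⟩⟩
  simp

lemma isH1_conj {u : E n → ℂ} {g : Fin n → E n → ℂ} (hu : IsH1 Ω u g) :
    IsH1 Ω (fun x => (starRingEnd ℂ) (u x)) (fun i x => (starRingEnd ℂ) (g i x)) := by
  have m : ∀ {u : E n → ℂ}, MemL2 Ω u → MemL2 Ω (fun x => (starRingEnd ℂ) (u x)) :=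
    fun hu => MemLp.star hu
  refine ⟨m hu.1, fun i => ⟨m (hu.2 i).1, fun φ hφ => ?_⟩⟩
  have l : ∀ (f : E n → ℝ) (u : E n → ℂ), ∫ x in Ω, f x • (starRingEnd ℂ) (u x)
      = (starRingEnd ℂ) (∫ x in Ω, f x • u x) := by
    intro f u
    rw [← integral_conj]
    congr 1 with x
    simp
  rw [l, l, (hu.2 i).2 φ hφ, map_neg]

lemma NeumannLaplacian.memL2_laplacian {u v : E n → ℂ} (h : NeumannLaplacian Ω u v) : MemL2 Ω v := by
  obtain ⟨g, H, h1, h2, -⟩ := h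
  have : MemL2 Ω (fun x => ∑ i, H i i x) :=
    memLp_finsetSum _ fun i _ => ((h1.2 i).2 i).1
  exact (memLp_congr_ae h2).2 this

lemma NeumannLaplacian.congr {u v v' : E n → ℂ} (h : NeumannLaplacian Ω u v)
    (hv : ∀ᵐ x ∂(volume.restrict Ω), v' x = v x) : NeumannLaplacian Ω u v' := by
  obtain ⟨g, H, h1, h2, h3⟩ := h
  refine ⟨g, H, h1, ?_, fun ψ q hψ => ?_⟩
  · filter_upwards [hv, h2] with x a b
    rw [a, b]
  · rw [h3 ψ q hψ]
    congr 1
    apply integral_congr_ae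
    filter_upwards [hv] with x a
    rw [a]

lemma neumannLaplacian_zero : NeumannLaplacian Ω (fun _ => 0) (fun _ => 0) := by
  refine ⟨fun _ _ => 0, fun _ _ _ => 0, ⟨isH1_zero, fun _ => isH1_zero⟩, ?_, fun ψ q _ => ?_⟩
  · simp
  · simp

lemma NeumannLaplacian.lin {u v u' v' : E n → ℂ} (h : NeumannLaplacian Ω u v)
    (h' : NeumannLaplacian Ω u' v') (k : ℂ) :
    NeumannLaplacian Ω (fun x => u x + k * u' x) (fun x => v x + k * v' x) := by
  have mv := h.memL2_laplacian
  have mv' := h'.memL2_laplacian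
  obtain ⟨g, H, h1, h2, h3⟩ := h
  obtain ⟨g', H', h1', h2', h3'⟩ := h'
  refine ⟨fun i x => g i x + k * g' i x, fun i j x => H i j x + k * H' i j x,
    ⟨h1.1.lin h1'.1 k, fun i => (h1.2 i).lin (h1'.2 i) k⟩, ?_, fun ψ q hψ => ?_⟩
  · filter_upwards [h2, h2'] with x a b
    rw [a, b, Finset.mul_sum, Finset.sum_add_distrib]
  · have i1 : ∀ {g : Fin n → E n → ℂ}, (∀ i, MemL2 Ω (g i)) →
        Integrable (fun x => ∑ i, g i x * q i x) (volume.restrict Ω) := fun hg =>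
      integrable_finsetSum _ fun i _ => (hg i).integrable_mul (hψ.2 i).1
    have e1 : ∫ x in Ω, ∑ i, (g i x + k * g' i x) * q i x
        = (∫ x in Ω, ∑ i, g i x * q i x) + k * ∫ x in Ω, ∑ i, g' i x * q i x := by
      rw [← integral_const_mul, ← integral_add (i1 fun i => (h1.1.2 i).1)
        ((i1 fun i => (h1'.1.2 i).1).const_mul k)]
      congr 1 with x
      rw [Finset.mul_sum, ← Finset.sum_add_distrib]
      exact Finset.sum_congr rfl fun i _ => by ring
    have e2 : ∫ x in Ω, (v x + k * v' x) * ψ x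
        = (∫ x in Ω, v x * ψ x) + k * ∫ x in Ω, v' x * ψ x := by
      rw [← integral_const_mul, ← integral_add (mv.integrable_mul hψ.1)
        ((mv'.integrable_mul hψ.1).const_mul k)]
      congr 1 with x
      ring
    rw [e1, e2, h3 ψ q hψ, h3' ψ q hψ]
    ring

lemma NeumannLaplacian.const_mul {u v : E n → ℂ} (h : NeumannLaplacian Ω u v) (k : ℂ) :
    NeumannLaplacian Ω (fun x => k * u x) (fun x => k * v x) := by
  simpa using neumannLaplacian_zero.lin h k

lemma NeumannLaplacian.sum {ι : Type*} (s : Finset ι) {u v : ι → E n → ℂ}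
    (h : ∀ i, NeumannLaplacian Ω (u i) (v i)) (w : ι → ℂ) :
    NeumannLaplacian Ω (fun x => ∑ i ∈ s, w i * u i x) (fun x => ∑ i ∈ s, w i * v i x) := by
  classical
  induction s using Finset.induction_on with
  | empty => simpa using neumannLaplacian_zero
  | insert i s hi ih =>
    simp only [Finset.sum_insert hi]
    simpa only [add_comm] using ih.lin (h i) (w i)

/-! ### Sign of the Neumann eigenvalues -/

/-- Green's formula tested with the conjugate of an eigenfunction. -/
lemma green_conj {l : ℂ} {e : E n → ℂ} (h : NeumannLaplacian Ω e (fun x => l * e x)) :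
    ∃ g : Fin n → E n → ℂ, IsH1 Ω e g ∧
      ((∫ x in Ω, ∑ i, ‖g i x‖ ^ 2 : ℝ) : ℂ) = -(l * (∫ x in Ω, ‖e x‖ ^ 2 : ℝ)) := by
  obtain ⟨g, H, h1, -, h3⟩ := h
  refine ⟨g, h1.1, ?_⟩
  have e1 : ((∫ x in Ω, ∑ i, ‖g i x‖ ^ 2 : ℝ) : ℂ)
      = ∫ x in Ω, ∑ i, g i x * (starRingEnd ℂ) (g i x) := by
    rw [← integral_complex_ofReal]
    congr 1 with x
    push_cast
    exact Finset.sum_congr rfl fun i _ => by rw [Complex.mul_conj']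
  have e2 : l * (∫ x in Ω, ‖e x‖ ^ 2 : ℝ) = ∫ x in Ω, l * e x * (starRingEnd ℂ) (e x) := by
    rw [← integral_complex_ofReal, ← integral_const_mul]
    congr 1 with x
    rw [mul_assoc, Complex.mul_conj']
    push_cast
    rfl
  rw [e1, e2]
  exact h3 _ _ (isH1_conj h1.1)

lemma MemL2.integral_norm_sq_pos {e : E n → ℂ} (he : MemL2 Ω e)
    (h0 : ¬ ∀ᵐ x ∂(volume.restrict Ω), e x = 0) : 0 < ∫ x in Ω, ‖e x‖ ^ 2 := by
  have hi : Integrable (fun x => ‖e x‖ ^ 2) (volume.restrict Ω) :=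
    MemLp.integrable_norm_pow he (by simp)
  refine lt_of_le_of_ne (integral_nonneg fun x => by positivity) fun h => h0 ?_
  have := (integral_eq_zero_iff_of_nonneg (fun x => by positivity) hi).1 h.symm
  filter_upwards [this] with x hx
  simpa using hx

/-- The Neumann Laplacian is symmetric and nonpositive: a complex eigenvalue is real and
nonpositive. -/
lemma eigenvalue_real {l : ℂ} {e : E n → ℂ} (h : NeumannLaplacian Ω e (fun x => l * e x))
    (h0 : ¬ ∀ᵐ x ∂(volume.restrict Ω), e x = 0) : ∃ ρ : ℝ, 0 ≤ ρ ∧ l = -(ρ : ℂ) := by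
  obtain ⟨g, hg, hG⟩ := green_conj h
  have he := hg.1.integral_norm_sq_pos h0
  refine ⟨(∫ x in Ω, ∑ i, ‖g i x‖ ^ 2) / ∫ x in Ω, ‖e x‖ ^ 2, ?_, ?_⟩
  · exact div_nonneg (integral_nonneg fun x => by positivity) he.le
  · push_cast
    rw [hG]
    have : ((∫ x in Ω, ‖e x‖ ^ 2 : ℝ) : ℂ) ≠ 0 := by exact_mod_cast he.ne'
    field_simp

lemma neumannSpectrum_nonneg {ρ : ℝ} (hρ : ρ ∈ neumannSpectrum Ω) : 0 ≤ ρ := by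
  obtain ⟨e, h, h0⟩ := hρ
  obtain ⟨r, hr, hr'⟩ := eigenvalue_real h h0
  have : ρ = r := by exact_mod_cast neg_injective hr'
  rwa [this]

/-! ### The eigenvalue zero -/

lemma isH1_const (hb : Bornology.IsBounded Ω) (k : ℂ) : IsH1 Ω (fun _ => k) (fun _ _ => 0) := by
  have : IsFiniteMeasure (volume.restrict Ω) :=
    isFiniteMeasure_restrict.2 hb.measure_lt_top.ne
  refine ⟨memLp_const k, fun i => ⟨MemLp.zero, fun φ hφ => ?_⟩⟩
  -- a test function is supported in `Ω`, and the integral of its partial derivative vanishes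
  have h1 : ∫ x in Ω, fderiv ℝ φ x (EuclideanSpace.single i 1)
      = ∫ x, fderiv ℝ φ x (EuclideanSpace.single i 1) := by
    apply setIntegral_eq_integral_of_forall_compl_eq_zero
    intro x hx
    have : fderiv ℝ φ x = 0 := by
      by_contra hne
      exact hx (hφ.2.2 (support_fderiv_subset ℝ hne))
    simp [this]
  have hd : Differentiable ℝ φ := hφ.1.differentiable (by simp)
  have h2 : ∫ x, fderiv ℝ φ x (EuclideanSpace.single i 1) = 0 := by
    have := integral_smul_fderiv_eq_neg_fderiv_smul_of_integrable (μ := (volume : Measure (E n)))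
      (𝕜 := ℝ) (f := fun _ => (1 : ℝ)) (g := φ) (v := EuclideanSpace.single i 1) (by simp)
      (by
        simpa using (hφ.continuous_partial (EuclideanSpace.single i
          1)).integrable_of_hasCompactSupport (μ := volume) (hφ.hasCompactSupport_partial _))
      (by simpa using hφ.continuous.integrable_of_hasCompactSupport hφ.2.1)
      (by fun_prop) (fun x _ => hd x)
    simpa using this
  simp only [integral_smul_const, h1, h2]
  simp

lemma zero_mem_neumannSpectrum (ho : IsOpen Ω) (hne : Ω.Nonempty) (hb : Bornology.IsBounded Ω) :
    0 ∈ neumannSpectrum Ω := by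
  refine ⟨fun _ => 1, ⟨fun _ _ => 0, fun _ _ _ => 0,
    ⟨isH1_const hb 1, fun _ => isH1_zero⟩, by simp, by simp⟩, ?_⟩
  have : volume Ω ≠ 0 := (ho.measure_pos volume hne).ne'
  simpa [ae_iff] using this

open ContinuousLinearMap in
/-- A function with vanishing weak gradient is almost everywhere constant near each point of `Ω`:
its mollifications have vanishing gradient, and they converge to it almost everywhere. -/
lemma ae_const_near (ho : IsOpen Ω) (hb : Bornology.IsBounded Ω) {e : E n → ℂ}
    (he : IsH1 Ω e (fun _ _ => 0)) {x₀ : E n} (hx₀ : x₀ ∈ Ω) :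
    ∃ r > 0, Metric.ball x₀ r ⊆ Ω ∧
      ∃ k : ℂ, ∀ᵐ x ∂(volume.restrict (Metric.ball x₀ r)), e x = k := by
  have : IsFiniteMeasure (volume.restrict Ω) :=
    isFiniteMeasure_restrict.2 hb.measure_lt_top.ne
  obtain ⟨R, hR, hball⟩ := Metric.isOpen_iff.1 ho x₀ hx₀
  -- kernels of radius at most `R / 2` centred in the ball of radius `R / 2` stay inside `Ω`
  set r := R / 2 with hr
  have hr0 : 0 < r := by positivity
  have hsub : Metric.ball x₀ r ⊆ Ω := (Metric.ball_subset_ball (by linarith)).trans hball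
  refine ⟨r, hr0, hsub, ?_⟩
  set f : E n → ℂ := Ω.indicator e with hf
  have hfi : Integrable f := by
    rw [hf, integrable_indicator_iff ho.measurableSet]
    exact MemLp.integrable (by norm_num) he.1
  have hfl : LocallyIntegrable f := hfi.locallyIntegrable
  let φ : ℕ → ContDiffBump (0 : E n) := fun m =>
    ⟨r / 4 / (m + 1), r / 2 / (m + 1), by positivity, by
      apply div_lt_div_of_pos_right _ (by positivity); linarith⟩
  have hφ0 : Filter.Tendsto (fun m => (φ m).rOut) Filter.atTop (nhds 0) := by
    have := (tendsto_one_div_add_atTop_nhds_zero_nat (𝕜 := ℝ)).const_mul (r / 2)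
    simpa [φ, div_eq_mul_inv] using this
  have hae := ContDiffBump.ae_convolution_tendsto_right_of_locallyIntegrable (φ := φ) (K := 2)
    hφ0 (Filter.Eventually.of_forall fun m => by simp only [φ]; ring_nf; rfl) hfl
  -- the mollifications are constant on the ball
  have hconst : ∀ m, ∀ x ∈ Metric.ball x₀ r, ∀ y ∈ Metric.ball x₀ r,
      convolution ((φ m).normed volume) f (lsmul ℝ ℝ) volume x
        = convolution ((φ m).normed volume) f (lsmul ℝ ℝ) volume y := by
    intro m
    have hη : ContDiff ℝ ∞ ((φ m).normed volume) := (φ m).contDiff_normed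
    have hηc : HasCompactSupport ((φ m).normed volume) := (φ m).hasCompactSupport_normed
    have hd := hηc.hasFDerivAt_convolution_right (lsmul ℝ ℝ : ℝ →L[ℝ] ℂ →L[ℝ] ℂ).flip hfl
      (hη.of_le (by simp))
    rw [convolution_flip] at hd
    have hz : ∀ x ∈ Metric.ball x₀ r,
        convolution f (fderiv ℝ ((φ m).normed volume))
          ((lsmul ℝ ℝ : ℝ →L[ℝ] ℂ →L[ℝ] ℂ).flip.precompR (E n)) volume x = 0 := by
      intro x hx
      have hsupp : tsupport (fun t => (φ m).normed volume (x - t)) ⊆ Ω := by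
        have : Function.support (fun t => (φ m).normed volume (x - t))
            ⊆ Metric.closedBall x (φ m).rOut := by
          intro t ht
          have : x - t ∈ Function.support ((φ m).normed volume) := ht
          rw [(φ m).support_normed_eq, mem_ball_zero_iff] at this
          rw [Metric.mem_closedBall, dist_comm, dist_eq_norm]
          exact this.le
        refine (closure_minimal this Metric.isClosed_closedBall).trans
          (Subset.trans ?_ hball)
        refine Metric.closedBall_subset_ball' ?_
        have h1 : (φ m).rOut ≤ r / 2 := by
          simp only [φ]
          exact div_le_self (by positivity) (by linarith [(Nat.cast_nonneg m : (0 : ℝ) ≤ m)])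
        have h2 := Metric.mem_ball.1 hx
        linarith
      -- the translated reflected kernel is a test function on `Ω`
      have htest : IsTest Ω (fun t => (φ m).normed volume (x - t)) := by
        refine ⟨hη.comp (contDiff_const.sub contDiff_id), ?_, hsupp⟩
        exact hηc.comp_homeomorph (Homeomorph.subLeft x)
      have hbasis : ∀ i, convolution f (fderiv ℝ ((φ m).normed volume))
          ((lsmul ℝ ℝ : ℝ →L[ℝ] ℂ →L[ℝ] ℂ).flip.precompR (E n)) volume x
            (EuclideanSpace.single i 1) = 0 := by
        intro i
        have h0 := (he.2 i).2 _ htest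
        simp only [smul_zero, integral_zero, neg_zero] at h0
        rw [convolution_precompR_apply _ hfl (hηc.fderiv ℝ) (hη.continuous_fderiv (by simp)),
          convolution_def]
        have h1 : ∀ t, fderiv ℝ (fun t => (φ m).normed volume (x - t)) t
            (EuclideanSpace.single i 1)
              = -(fderiv ℝ ((φ m).normed volume) (x - t) (EuclideanSpace.single i 1)) := by
          intro t
          have h := ((hη.differentiable (by simp)) (x - t)).hasFDerivAt.comp t
            ((hasFDerivAt_id t).const_sub x)
          have h' := h.fderiv
          simp only [Function.comp_def] at h'
          rw [h']
          simp
        simp only [h1, neg_smul, integral_neg, neg_eq_zero] at h0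
        rw [← h0, ← integral_indicator ho.measurableSet]
        congr 1 with t
        by_cases ht : t ∈ Ω <;> simp [hf, ht]
      apply ContinuousLinearMap.coe_injective
      refine (EuclideanSpace.basisFun (Fin n) ℝ).toBasis.ext fun i => ?_
      simpa using hbasis i
    intro x hx y hy
    refine (convex_ball x₀ r).is_const_of_fderivWithin_eq_zero (𝕜 := ℝ)
      (fun z hz' => (hd z).differentiableAt.differentiableWithinAt) (fun z hz' => ?_) hx hy
    rw [fderivWithin_of_isOpen Metric.isOpen_ball hz', (hd z).fderiv, hz z hz']
  have hpos : volume (Metric.ball x₀ r) ≠ 0 := (Metric.measure_ball_pos volume x₀ hr0).ne'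
  have hNe : (ae (volume.restrict (Metric.ball x₀ r))).NeBot := by
    rw [ae_neBot]; simpa using hpos
  have hae' := (ae_restrict_of_ae (s := Metric.ball x₀ r) hae).and
    (ae_restrict_mem measurableSet_ball)
  obtain ⟨x₁, h₁, h₁'⟩ := hae'.exists
  refine ⟨f x₁, ?_⟩
  filter_upwards [hae'] with x hx
  have : f x = f x₁ := by
    refine tendsto_nhds_unique hx.1 (h₁.congr fun m => ?_)
    exact hconst m _ h₁' _ hx.2
  rw [← this, hf, indicator_of_mem (hsub hx.2)]

/-- On a connected open set, a function with vanishing weak gradient is almost everywhere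
constant. -/
lemma ae_const_of_weak_gradient_zero (ho : IsOpen Ω) (hc : IsConnected Ω)
    (hb : Bornology.IsBounded Ω) {e : E n → ℂ} (he : IsH1 Ω e (fun _ _ => 0)) :
    ∃ k : ℂ, ∀ᵐ x ∂(volume.restrict Ω), e x = k := by
  choose! r hr hsub K hK using fun x₀ (hx₀ : x₀ ∈ Ω) => ae_const_near ho hb he hx₀
  obtain ⟨x₁, hx₁⟩ := hc.nonempty
  have hconst : ∀ x ∈ Ω, K x = K x₁ := by
    intro x hx
    refine hc.isPreconnected.induction₂ (fun x y => K x = K y) (fun x hx => ?_)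
      (fun x y z _ _ _ h h' => h.trans h') (fun x y _ _ h => h.symm) hx hx₁
    filter_upwards [nhdsWithin_le_nhds (Metric.ball_mem_nhds x (hr x hx)), self_mem_nhdsWithin]
      with y hy hyΩ
    -- the two balls overlap in a set of positive measure
    have ho' : IsOpen (Metric.ball x (r x) ∩ Metric.ball y (r y)) :=
      Metric.isOpen_ball.inter Metric.isOpen_ball
    have hpos := (ho'.measure_pos volume ⟨y, hy, Metric.mem_ball_self (hr y hyΩ)⟩).ne'
    have hNe : (ae (volume.restrict (Metric.ball x (r x) ∩ Metric.ball y (r y)))).NeBot := by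
      rw [ae_neBot]; simpa using hpos
    have a1 := ae_restrict_of_ae_restrict_of_subset
      (inter_subset_left (s := Metric.ball x (r x)) (t := Metric.ball y (r y))) (hK x hx)
    have a2 := ae_restrict_of_ae_restrict_of_subset
      (inter_subset_right (s := Metric.ball x (r x)) (t := Metric.ball y (r y))) (hK y hyΩ)
    obtain ⟨t, h1, h2⟩ := (a1.and a2).exists
    exact h1.symm.trans h2
  refine ⟨K x₁, ?_⟩
  rw [ae_restrict_iff' ho.measurableSet]
  refine measure_null_of_locally_null _ fun x hx => ?_
  have hxΩ : x ∈ Ω := by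
    by_contra h
    exact hx fun h' => absurd h' h
  refine ⟨_, Filter.inter_mem (nhdsWithin_le_nhds (Metric.ball_mem_nhds x (hr x hxΩ)))
    self_mem_nhdsWithin, ?_⟩
  have := hK x hxΩ
  rw [ae_restrict_iff' measurableSet_ball, hconst x hxΩ] at this
  refine measure_mono_null (fun t ht => ?_) this
  exact fun h => ht.2 fun _ => h ht.1

lemma neumann_zero_const (ho : IsOpen Ω) (hc : IsConnected Ω) (hb : Bornology.IsBounded Ω)
    {e : E n → ℂ} (he : IsNeumannEigenfunction Ω 0 e) :
    ∃ k : ℂ, ∀ᵐ x ∂(volume.restrict Ω), e x = k := by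
  obtain ⟨g, hg, hG⟩ := green_conj he.1
  have hi : ∀ i, Integrable (fun x => ‖g i x‖ ^ 2) (volume.restrict Ω) := fun i =>
    MemLp.integrable_norm_pow (hg.2 i).1 (by simp)
  have h0 : ∫ x in Ω, ∑ i, ‖g i x‖ ^ 2 = 0 := by
    simp only [Complex.ofReal_zero, neg_zero, zero_mul] at hG
    exact_mod_cast hG
  have h1 := (integral_eq_zero_iff_of_nonneg (fun x => by positivity)
    (integrable_finsetSum _ fun i _ => hi i)).1 h0
  refine ae_const_of_weak_gradient_zero ho hc hb
    ⟨hg.1, fun i => ⟨MemLp.zero, fun φ hφ => ?_⟩⟩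
  rw [(hg.2 i).2 φ hφ]
  congr 1
  apply integral_congr_ae
  filter_upwards [h1] with x hx
  have := (Finset.sum_eq_zero_iff_of_nonneg (fun i _ => by positivity)).1 hx i (Finset.mem_univ i)
  have : g i x = 0 := by simpa using this
  rw [this]

/-! ### Reduction of a linear system to the modes -/

section Reduction

variable {X : Type*} [MeasurableSpace X] {μ : Measure X} {m : ℕ}

/-- If a product of factors `B - r` annihilates the nonzero vector function `u`, then some
polynomial in `B` maps `u` to a nonzero function with values in an eigenspace of `B`. -/
lemma exists_polynomial_eigenvector (B : Matrix (Fin m) (Fin m) ℂ) (u : X → Fin m → ℂ)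
    (hu : ¬ ∀ᵐ x ∂μ, u x = 0) (s : Multiset ℂ)
    (hs : ∀ᵐ x ∂μ, (Polynomial.aeval B ((s.map fun r => Polynomial.X - Polynomial.C r).prod)).mulVec
      (u x) = 0) :
    ∃ (P : Polynomial ℂ) (l : ℂ), (¬ ∀ᵐ x ∂μ, (Polynomial.aeval B P).mulVec (u x) = 0) ∧
      ∀ᵐ x ∂μ, B.mulVec ((Polynomial.aeval B P).mulVec (u x))
        = l • (Polynomial.aeval B P).mulVec (u x) := by
  induction s using Multiset.induction_on with
  | empty => exact absurd (by simpa using hs) hu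
  | cons r s ih =>
    by_cases h : ∀ᵐ x ∂μ, (Polynomial.aeval B
        ((s.map fun r => Polynomial.X - Polynomial.C r).prod)).mulVec (u x) = 0
    · exact ih h
    · refine ⟨_, r, h, ?_⟩
      filter_upwards [hs] with x hx
      rw [Multiset.map_cons, Multiset.prod_cons, map_mul, ← Matrix.mulVec_mulVec] at hx
      simp only [map_sub, Polynomial.aeval_X, Polynomial.aeval_C, Matrix.sub_mulVec,
        sub_eq_zero] at hx
      rw [hx, Algebra.algebraMap_eq_smul_one, Matrix.smul_mulVec, Matrix.one_mulVec]

/-- `exists_polynomial_eigenvector` applied to the roots of the characteristic polynomial, by the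
Cayley–Hamilton theorem. -/
lemma exists_polynomial_eigenvector' (B : Matrix (Fin m) (Fin m) ℂ) (u : X → Fin m → ℂ)
    (hu : ¬ ∀ᵐ x ∂μ, u x = 0) :
    ∃ (P : Polynomial ℂ) (l : ℂ), (¬ ∀ᵐ x ∂μ, (Polynomial.aeval B P).mulVec (u x) = 0) ∧
      ∀ᵐ x ∂μ, B.mulVec ((Polynomial.aeval B P).mulVec (u x))
        = l • (Polynomial.aeval B P).mulVec (u x) := by
  refine exists_polynomial_eigenvector B u hu B.charpoly.roots ?_
  have h := (IsAlgClosed.splits B.charpoly).eq_prod_roots_of_monic B.charpoly_monic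
  rw [← h, Matrix.aeval_self_charpoly]
  simp

end Reduction

/-- A nonzero solution of `Δu = B u` with Neumann conditions forces `B + ρ` to be singular for
some Neumann eigenvalue `ρ`. No completeness of the eigenfunctions is needed: a suitable
polynomial in `B` maps `u` to a vector of eigenfunctions. -/
lemma exists_mode {m : ℕ} (B : Matrix (Fin m) (Fin m) ℂ) (u : Fin m → E n → ℂ)
    (hu : ¬ ∀ᵐ x ∂(volume.restrict Ω), ∀ i, u i x = 0)
    (hB : ∀ i, NeumannLaplacian Ω (u i) (fun x => ∑ j, B i j * u j x)) :
    ∃ ρ ∈ neumannSpectrum Ω, ∃ w : Fin m → ℂ, w ≠ 0 ∧ B.mulVec w = (-(ρ : ℂ)) • w := by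
  have hu' : ¬ ∀ᵐ x ∂(volume.restrict Ω), (fun i => u i x) = 0 := by
    intro h
    apply hu
    filter_upwards [h] with x hx i
    exact congrFun hx i
  obtain ⟨P, l, h1, h2⟩ := exists_polynomial_eigenvector' B _ hu'
  set T := Polynomial.aeval B P with hT
  have hcomm : B * T = T * B := by
    have h := congrArg (Polynomial.aeval B) (Polynomial.X_mul (p := P))
    simpa using h
  set w : E n → Fin m → ℂ := fun x => T.mulVec (fun i => u i x) with hw
  have hΔ : ∀ i, NeumannLaplacian Ω (fun x => w x i) (fun x => l * w x i) := by
    intro i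
    have h := NeumannLaplacian.sum Finset.univ hB (T i)
    refine h.congr ?_
    filter_upwards [h2] with x hx
    have h3 : B.mulVec (w x) = T.mulVec (B.mulVec fun i => u i x) := by
      rw [hw, Matrix.mulVec_mulVec, hcomm, Matrix.mulVec_mulVec]
    have h4 := congrFun (h3.symm.trans hx) i
    exact h4.symm
  obtain ⟨i, hi⟩ : ∃ i, ¬ ∀ᵐ x ∂(volume.restrict Ω), w x i = 0 := by
    by_contra! h
    apply h1
    filter_upwards [ae_all_iff.2 h] with x hx
    exact funext hx
  obtain ⟨ρ, -, rfl⟩ := eigenvalue_real (hΔ i) hi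
  refine ⟨ρ, ⟨_, hΔ i, hi⟩, ?_⟩
  by_contra! h
  apply h1
  filter_upwards [h2] with x hx
  by_contra h5
  exact h _ h5 hx

namespace Params

variable (p : Params)

/-- The diffusion coefficients. -/
def diff : Fin 3 → ℝ := ![p.μ₁, p.μ₂, p.μ₃]

lemma diff_pos (i : Fin 3) : 0 < p.diff i := by
  fin_cases i
  exacts [p.μ₁_pos, p.μ₂_pos, p.μ₃_pos]

/-- The complexification of the matrix of a mode. -/
abbrev Mc (ρ δ : ℝ) : Matrix (Fin 3) (Fin 3) ℂ := (p.M ρ δ).map (algebraMap ℝ ℂ)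

/-- `M ρ δ` is `M 0 δ` minus `ρ` times the diffusion matrix. -/
lemma Mc_mulVec (ρ δ : ℝ) (w : Fin 3 → ℂ) (i : Fin 3) :
    (p.Mc ρ δ).mulVec w i = (p.Mc 0 δ).mulVec w i - p.diff i * ρ * w i := by
  fin_cases i <;> simp [Matrix.mulVec, dotProduct, Fin.sum_univ_three, M, diff] <;> ring

/-- The linearized problem in matrix form. -/
lemma isEigenfunction_iff {δ : ℝ} {z : ℂ} {u : Fin 3 → E n → ℂ} :
    p.IsEigenfunction Ω δ z u ↔ ¬ (∀ᵐ x ∂(volume.restrict Ω), ∀ i, u i x = 0) ∧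
      ∃ v : Fin 3 → E n → ℂ, (∀ i, NeumannLaplacian Ω (u i) (v i)) ∧
        ∀ᵐ x ∂(volume.restrict Ω), ∀ i,
          p.diff i * v i x + (p.Mc 0 δ).mulVec (fun j => u j x) i = z * u i x := by
  unfold IsEigenfunction
  refine and_congr_right fun _ => exists_congr fun v => and_congr_right fun _ => ?_
  refine Filter.eventually_congr (Filter.Eventually.of_forall fun x => ?_)
  rw [Fin.forall_fin_succ, Fin.forall_fin_two]
  simp only [diff, Matrix.mulVec, dotProduct, Fin.sum_univ_three]
  simp [M]
  refine and_congr ?_ (and_congr ?_ ?_) <;> refine Eq.congr ?_ rfl <;> ring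

/-- The eigenvalues of the linearized problem are those of the matrices of the modes. -/
lemma isEigenvalue_iff {δ : ℝ} {z : ℂ} :
    p.IsEigenvalue Ω δ z ↔
      ∃ ρ ∈ neumannSpectrum Ω, ((p.M ρ δ).map (algebraMap ℝ ℂ)).charpoly.eval z = 0 := by
  have key : ∀ ρ : ℝ, ((p.M ρ δ).map (algebraMap ℝ ℂ)).charpoly.eval z = 0 ↔
      ∃ w : Fin 3 → ℂ, w ≠ 0 ∧ (p.Mc ρ δ).mulVec w = z • w := by
    intro ρ
    rw [Matrix.eval_charpoly, ← Matrix.exists_mulVec_eq_zero_iff]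
    refine exists_congr fun w => and_congr_right fun _ => ?_
    rw [Matrix.sub_mulVec, sub_eq_zero, eq_comm, Matrix.scalar_apply,
      ← Matrix.smul_one_eq_diagonal, Matrix.smul_mulVec, Matrix.one_mulVec]
  have hd : ∀ i, (p.diff i : ℂ) ≠ 0 := fun i => by exact_mod_cast (p.diff_pos i).ne'
  constructor
  · rintro ⟨u, hu⟩
    obtain ⟨h0, v, hv, hE⟩ := (p.isEigenfunction_iff).1 hu
    -- the system reads `Δu = B u`
    let B : Matrix (Fin 3) (Fin 3) ℂ :=
      Matrix.of fun i j => (p.diff i : ℂ)⁻¹ * ((z • (1 : Matrix (Fin 3) (Fin 3) ℂ) - p.Mc 0 δ) i j)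
    have hBw : ∀ (w : Fin 3 → ℂ) i,
        B.mulVec w i = (p.diff i : ℂ)⁻¹ * (z * w i - (p.Mc 0 δ).mulVec w i) := by
      intro w i
      have : B.mulVec w i = (p.diff i : ℂ)⁻¹ *
          ((z • (1 : Matrix (Fin 3) (Fin 3) ℂ) - p.Mc 0 δ).mulVec w i) := by
        simp only [B, Matrix.mulVec, dotProduct, Matrix.of_apply, Finset.mul_sum, mul_assoc]
      rw [this, Matrix.sub_mulVec, Matrix.smul_mulVec, Matrix.one_mulVec]
      rfl
    obtain ⟨ρ, hρ, w, hw, hBρ⟩ := exists_mode B u h0 (fun i => (hv i).congr (by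
      filter_upwards [hE] with x hx
      have h1 := hBw (fun j => u j x) i
      have h2 : ∑ j, B i j * u j x = B.mulVec (fun j => u j x) i := rfl
      rw [h2, h1, ← hx i]
      field_simp [hd i]
      ring))
    refine ⟨ρ, hρ, (key ρ).2 ⟨w, hw, ?_⟩⟩
    ext i
    have h1 := congrFun hBρ i
    rw [hBw, inv_mul_eq_iff_eq_mul₀ (hd i)] at h1
    rw [Mc_mulVec]
    simp only [Pi.smul_apply, smul_eq_mul] at *
    linear_combination -h1
  · rintro ⟨ρ, ⟨e, he, he0⟩, hz⟩
    obtain ⟨w, hw, hwz⟩ := (key ρ).1 hz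
    refine ⟨fun i x => w i * e x, (p.isEigenfunction_iff).2 ⟨?_, _,
      fun i => he.const_mul (w i), Filter.Eventually.of_forall fun x i => ?_⟩⟩
    · intro h
      apply he0
      obtain ⟨i, hi⟩ := Function.ne_iff.1 hw
      filter_upwards [h] with x hx
      exact (mul_eq_zero.1 (hx i)).resolve_left hi
    · have h1 := congrFun hwz i
      rw [Mc_mulVec] at h1
      have h2 : (fun j => w j * e x) = e x • w := by
        ext j; simp [mul_comm]
      rw [h2, Matrix.mulVec_smul]
      simp only [Pi.smul_apply, smul_eq_mul] at *
      linear_combination e x * h1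

end Params

/-! ### The numbering of the eigenvalues -/

lemma continuous_quadHi : Continuous fun x : ℝ × ℝ => quadHi x.1 x.2 := by
  have : (fun x : ℝ × ℝ => quadHi x.1 x.2) = fun x =>
      (((x.1 + √(x.1 ^ 2 - 4 * x.2)) / 2 : ℝ) : ℂ)
        + ((√(4 * x.2 - x.1 ^ 2) / 2 : ℝ) : ℂ) * Complex.I := by
    ext1 x
    apply Complex.ext <;> simp [quadHi]
  rw [this]
  fun_prop

namespace Params

variable (p : Params)

/-- The largest real eigenvalue of `M ρ δ`. -/
def top (ρ δ : ℝ) : ℝ := topRoot (p.coeff₂ ρ δ) (p.coeff₁ ρ δ) (p.coeff₀ ρ δ)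

/-- The smallest real eigenvalue of `M 0 δ`. -/
def bot (δ : ℝ) : ℝ := botRoot (p.coeff₂ 0 δ) (p.coeff₁ 0 δ) (p.coeff₀ 0 δ)

/-- The numbering of the eigenvalues of `M ρ δ`. If `ρ ≠ 0`, the largest real eigenvalue comes
first; if `ρ = 0`, the smallest real eigenvalue comes last. -/
def label (ρ : ℝ) (j : Fin 3) (δ : ℝ) : ℂ :=
  if ρ = 0 then
    ![quadHi (cosum (p.coeff₂ 0 δ) (p.bot δ)) (coprod (p.coeff₂ 0 δ) (p.coeff₁ 0 δ) (p.bot δ)),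
      quadLo (cosum (p.coeff₂ 0 δ) (p.bot δ)) (coprod (p.coeff₂ 0 δ) (p.coeff₁ 0 δ) (p.bot δ)),
      (p.bot δ : ℂ)] j
  else
    ![(p.top ρ δ : ℂ),
      quadHi (cosum (p.coeff₂ ρ δ) (p.top ρ δ)) (coprod (p.coeff₂ ρ δ) (p.coeff₁ ρ δ) (p.top ρ δ)),
      quadLo (cosum (p.coeff₂ ρ δ) (p.top ρ δ))
        (coprod (p.coeff₂ ρ δ) (p.coeff₁ ρ δ) (p.top ρ δ))] j

lemma cubic_eq_label (ρ δ : ℝ) (w : ℂ) :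
    cubic (p.coeff₂ ρ δ : ℂ) (p.coeff₁ ρ δ) (p.coeff₀ ρ δ) w
      = (w - p.label ρ 0 δ) * (w - p.label ρ 1 δ) * (w - p.label ρ 2 δ) := by
  by_cases hρ : ρ = 0
  · subst hρ
    have : cubic _ _ _ (p.bot δ) = 0 := cubic_botRoot _ _ _
    rw [cubic_factor this]
    simp only [label, if_true]
    simp
    ring
  · have : cubic _ _ _ (p.top ρ δ) = 0 := cubic_topRoot _ _ _
    rw [cubic_factor this]
    simp only [label, if_neg hρ]
    simp

lemma isLabelling_label {n : ℕ} (Ω : Set (E n)) : p.IsLabelling Ω p.label := by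
  intro ρ _ δ _
  rw [Fin.prod_univ_three]
  exact p.charpoly_eq (p.cubic_eq_label ρ δ)

lemma cubic_eq_zero_iff {ρ δ : ℝ} {z : ℂ} :
    cubic (p.coeff₂ ρ δ : ℂ) (p.coeff₁ ρ δ) (p.coeff₀ ρ δ) z = 0 ↔ ∃ j, z = p.label ρ j δ := by
  rw [cubic_eq_label, Fin.exists_fin_succ, Fin.exists_fin_two]
  simp [sub_eq_zero, or_assoc]

lemma label_re_neg {ρ δ : ℝ} (hρ : 0 ≤ ρ) (hδ : 0 < δ) (h0 : 0 < p.coeff₀ ρ δ)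
    (hH : 0 < p.hurwitz ρ δ) (j : Fin 3) : (p.label ρ j δ).re < 0 :=
  p.stable hρ hδ h0 hH (p.cubic_eq_zero_iff.2 ⟨j, rfl⟩)

lemma label_zero {ρ : ℝ} (hρ : ρ ≠ 0) (δ : ℝ) : p.label ρ 0 δ = p.top ρ δ := by
  simp [label, hρ]

lemma eigenvalue_re_neg {n : ℕ} {Ω : Set (E n)} (hb : p.b < 0) {δ : ℝ} (hδ : 0 < δ) {z : ℂ}
    (hz : p.IsEigenvalue Ω δ z) : z.re < 0 := by
  obtain ⟨ρ, hρ, h⟩ := p.isEigenvalue_iff.1 hz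
  have hρ0 := neumannSpectrum_nonneg hρ
  rw [eval_charpoly] at h
  refine p.stable hρ0 hδ ?_ (p.hurwitz_pos_of_b_neg hb hρ0 hδ) h
  have := p.μ₃_pos
  have := p.c_pos
  have hQ := p.Q_nonneg hρ0
  have : 0 ≤ p.μ₃ * ρ * (p.Q ρ - p.b) := mul_nonneg (by positivity) (by linarith)
  unfold coeff₀
  positivity

/-! ### The real eigenvalue of a critical mode -/

section Critical

variable {p} {ρ δ δ₁ : ℝ}

lemma top_eq_zero (hρ : 0 < ρ) (hδ : 0 < δ) (h0 : p.coeff₀ ρ δ = 0) (h1 : 0 < p.coeff₁ ρ δ) :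
    p.top ρ δ = 0 := by
  have h2 := p.coeff₂_pos hρ.le hδ
  have hr : cubic _ _ _ (p.top ρ δ) = 0 := cubic_topRoot _ _ _
  have hge : 0 ≤ p.top ρ δ := le_topRoot (by simp [cubic, h0])
  refine le_antisymm ?_ hge
  by_contra! h
  rw [h0] at hr
  unfold cubic at hr
  have : 0 < p.top ρ δ ^ 3 + p.coeff₂ ρ δ * p.top ρ δ ^ 2 + p.coeff₁ ρ δ * p.top ρ δ + 0 := by
    positivity
  linarith

lemma top_pos (h0 : p.coeff₀ ρ δ < 0) : 0 < p.top ρ δ :=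
  lt_topRoot (by simpa [cubic] using h0)

/-- If the constant coefficient is negative, the largest real eigenvalue is simple and continuous
in `δ`. -/
lemma top_simple_of_neg (hρ : 0 < ρ) (hδ : 0 < δ) (h0 : p.coeff₀ ρ δ < 0) :
    ContinuousAt (p.top ρ) δ ∧ 0 < cubicDeriv (p.coeff₂ ρ δ) (p.coeff₁ ρ δ) (p.top ρ δ) := by
  have h2 := p.coeff₂_pos hρ.le hδ
  have hr : cubic _ _ _ (p.top ρ δ) = 0 := cubic_topRoot _ _ _
  have hp := top_pos h0
  have hd : 0 < cubicDeriv (p.coeff₂ ρ δ) (p.coeff₁ ρ δ) (p.top ρ δ) := by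
    have e : p.top ρ δ * cubicDeriv (p.coeff₂ ρ δ) (p.coeff₁ ρ δ) (p.top ρ δ)
        = 2 * p.top ρ δ ^ 3 + p.coeff₂ ρ δ * p.top ρ δ ^ 2 - p.coeff₀ ρ δ := by
      unfold cubic at hr
      unfold cubicDeriv
      linear_combination hr
    refine (mul_pos_iff_of_pos_left hp).1 ?_
    rw [e]
    have : 0 < 2 * p.top ρ δ ^ 3 + p.coeff₂ ρ δ * p.top ρ δ ^ 2 := by positivity
    linarith
  exact ⟨continuousAt_topRoot (p.continuous_coeff₂ ρ) (p.continuous_coeff₁ ρ)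
    (p.continuous_coeff₀ ρ) hd (by unfold top at hp; linarith), hd⟩

/-- Simplicity and continuity of the largest real eigenvalue of a critical mode up to slightly
beyond `δ₁`. -/
lemma exists_top_simple (hρ : 0 < ρ) (hδ₁ : 0 < δ₁) (h0 : p.coeff₀ ρ δ₁ = 0)
    (h1 : 0 < p.coeff₁ ρ δ₁) :
    ∃ ε > 0, ∀ δ ∈ Ioo 0 (δ₁ + ε), ContinuousAt (p.top ρ) δ ∧
      0 < cubicDeriv (p.coeff₂ ρ δ) (p.coeff₁ ρ δ) (p.top ρ δ) := by
  have h2 := p.coeff₂_pos hρ.le hδ₁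
  have ht := top_eq_zero hρ hδ₁ h0 h1
  have hev := eventually_continuousAt_topRoot (p.continuous_coeff₂ ρ) (p.continuous_coeff₁ ρ)
    (p.continuous_coeff₀ ρ) (t := δ₁)
    (by unfold top at ht; simpa [ht, cubicDeriv] using h1)
    (by unfold top at ht; simpa [ht] using h2)
  obtain ⟨ε, hε, hball⟩ := Metric.eventually_nhds_iff_ball.1 hev
  refine ⟨ε, hε, fun δ hδ => ?_⟩
  rcases lt_or_ge δ δ₁ with h | h
  · exact top_simple_of_neg hρ hδ.1 (h0 ▸ p.coeff₀_lt hρ.le h)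
  · refine hball δ ?_
    rw [Real.ball_eq_Ioo]
    exact ⟨by linarith, hδ.2⟩

lemma label_ne_label_zero (hρ : ρ ≠ 0)
    (h : 0 < cubicDeriv (p.coeff₂ ρ δ) (p.coeff₁ ρ δ) (p.top ρ δ)) {j : Fin 3} (hj : j ≠ 0) :
    p.label ρ j δ ≠ p.label ρ 0 δ := by
  obtain ⟨h1, h2⟩ := ne_of_cubicDeriv_pos h
  rw [label_zero _ hρ]
  fin_cases j
  · exact absurd rfl hj
  · simpa [label, hρ] using h1
  · simpa [label, hρ] using h2

lemma label_re_neg_of_critical (hρ : 0 < ρ) (hδ : 0 < δ) (h0 : p.coeff₀ ρ δ = 0)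
    (h1 : 0 < p.coeff₁ ρ δ) {j : Fin 3} (hj : j ≠ 0) : (p.label ρ j δ).re < 0 := by
  have h2 := p.coeff₂_pos hρ.le hδ
  obtain ⟨e1, e2⟩ := quad_re_neg (s := -p.coeff₂ ρ δ) (q := p.coeff₁ ρ δ) (by linarith) h1
  have ht := top_eq_zero hρ hδ h0 h1
  fin_cases j
  · exact absurd rfl hj
  · simpa [label, hρ.ne', ht, cosum, coprod] using e1
  · simpa [label, hρ.ne', ht, cosum, coprod] using e2

end Critical

/-! ### The pair of eigenvalues of the zero mode -/

section ZeroMode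

variable {p} {δ : ℝ}

lemma coeff₀_zero_pos (hδ : 0 < δ) : 0 < p.coeff₀ 0 δ := by
  rw [coeff₀_zero]
  exact mul_pos hδ p.c_pos

lemma bot_neg (hδ : 0 < δ) : p.bot δ < 0 := botRoot_neg (coeff₀_zero_pos hδ)

/-- At `δ₀` the characteristic polynomial of the zero mode is `(z + P₂) (z² + P₁)`. -/
lemma bot_δ₀ (hb : 0 < p.b) : 0 < p.coeff₁ 0 p.δ₀ ∧ p.bot p.δ₀ = -p.coeff₂ 0 p.δ₀ := by
  obtain ⟨h0, hH⟩ := p.δ₀_spec hb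
  have hc := coeff₀_zero_pos (p := p) h0
  have h1 := p.coeff₁_pos le_rfl h0 (by linarith)
  refine ⟨h1, ?_⟩
  have hr : cubic _ _ _ (p.bot p.δ₀) = 0 := cubic_botRoot _ _ _
  unfold hurwitz at hH
  have : (p.bot p.δ₀ + p.coeff₂ 0 p.δ₀) * (p.bot p.δ₀ ^ 2 + p.coeff₁ 0 p.δ₀) = 0 := by
    unfold cubic at hr
    linear_combination hr + hH
  have h3 : p.bot p.δ₀ ^ 2 + p.coeff₁ 0 p.δ₀ ≠ 0 := by positivity
  linarith [(mul_eq_zero.1 this).resolve_right h3]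

/-- The first two eigenvalues of the zero mode are non-real and conjugate near `δ₀`. -/
lemma exists_pair (hb : 0 < p.b) :
    ∃ ε > 0, ContinuousOn (p.label 0 0) (Ioo (p.δ₀ - ε) (p.δ₀ + ε)) ∧
      ∀ δ ∈ Ioo (p.δ₀ - ε) (p.δ₀ + ε),
        (p.label 0 0 δ).im ≠ 0 ∧ p.label 0 0 δ = (starRingEnd ℂ) (p.label 0 1 δ) := by
  obtain ⟨h0, -⟩ := p.δ₀_spec hb
  obtain ⟨h1, hbot⟩ := bot_δ₀ hb
  have h2 := p.coeff₂_pos le_rfl h0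
  -- `botRoot` is minus the largest root of the reflected cubic, to which continuity applies
  have ht : topRoot (-p.coeff₂ 0 p.δ₀) (p.coeff₁ 0 p.δ₀) (-p.coeff₀ 0 p.δ₀)
      = p.coeff₂ 0 p.δ₀ := by
    unfold bot botRoot at hbot; linarith
  have hev := eventually_continuousAt_topRoot (p.continuous_coeff₂ 0).neg (p.continuous_coeff₁ 0)
    (p.continuous_coeff₀ 0).neg (t := p.δ₀)
    (by rw [Pi.neg_apply, Pi.neg_apply, ht]; unfold cubicDeriv; nlinarith)
    (by rw [Pi.neg_apply, Pi.neg_apply, ht]; linarith)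
  have hcont : ∀ᶠ δ in nhds p.δ₀, ContinuousAt p.bot δ := by
    filter_upwards [hev] with δ hδ
    exact hδ.1.neg
  have cs : ∀ {δ}, ContinuousAt p.bot δ →
      ContinuousAt (fun δ => cosum (p.coeff₂ 0 δ) (p.bot δ)) δ := fun h =>
    (p.continuous_coeff₂ 0).neg.continuousAt.sub h
  have cq : ∀ {δ}, ContinuousAt p.bot δ →
      ContinuousAt (fun δ => coprod (p.coeff₂ 0 δ) (p.coeff₁ 0 δ) (p.bot δ)) δ := fun h =>
    ((p.continuous_coeff₁ 0).continuousAt.add ((p.continuous_coeff₂ 0).continuousAt.mul h)).add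
      (h.pow 2)
  have hdisc : ∀ᶠ δ in nhds p.δ₀, cosum (p.coeff₂ 0 δ) (p.bot δ) ^ 2
      < 4 * coprod (p.coeff₂ 0 δ) (p.coeff₁ 0 δ) (p.bot δ) := by
    have hc := hcont.self_of_nhds
    refine ((cs hc).pow 2).eventually_lt (continuousAt_const.mul (cq hc)) ?_
    change cosum (p.coeff₂ 0 p.δ₀) (p.bot p.δ₀) ^ 2
      < 4 * coprod (p.coeff₂ 0 p.δ₀) (p.coeff₁ 0 p.δ₀) (p.bot p.δ₀)
    rw [hbot]
    unfold cosum coprod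
    nlinarith
  obtain ⟨ε, hε, hball⟩ := Metric.eventually_nhds_iff_ball.1 (hcont.and hdisc)
  rw [Real.ball_eq_Ioo] at hball
  refine ⟨ε, hε, fun δ hδ => ContinuousAt.continuousWithinAt ?_, fun δ hδ => ?_⟩
  · have hc := (hball δ hδ).1
    have h := continuous_quadHi.continuousAt.comp ((cs hc).prodMk (cq hc))
    have e : p.label 0 0 = (fun x : ℝ × ℝ => quadHi x.1 x.2) ∘ fun δ =>
        (cosum (p.coeff₂ 0 δ) (p.bot δ), coprod (p.coeff₂ 0 δ) (p.coeff₁ 0 δ) (p.bot δ)) := by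
      ext1 δ; simp [label]
    rw [e]
    exact h
  · have := quadHi_nonreal (hball δ hδ).2
    simpa [label] using this

lemma pair_re_eq_zero (hb : 0 < p.b) {j : Fin 3} (hj : j = 0 ∨ j = 1) :
    (p.label 0 j p.δ₀).re = 0 := by
  obtain ⟨h1, hbot⟩ := bot_δ₀ hb
  have e := quad_re_eq_zero h1
  rcases hj with rfl | rfl
  · simpa [label, cosum, coprod, hbot, pow_two] using e.1
  · simpa [label, cosum, coprod, hbot, pow_two] using e.2

lemma pair_re_pos (hb : 0 < p.b) (hδ : 0 < δ) (h : δ < p.δ₀) {j : Fin 3} (hj : j = 0 ∨ j = 1) :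
    0 < (p.label 0 j δ).re := by
  have hH := p.hurwitz_zero_neg hb hδ h
  unfold hurwitz at hH
  have hr : cubic _ _ _ (p.bot δ) = 0 := cubic_botRoot _ _ _
  obtain ⟨e1, e2⟩ := cosum_pos_of_unstable (coeff₀_zero_pos hδ) (by linarith) hr (bot_neg hδ)
  have e := quad_re_pos e1 e2
  rcases hj with rfl | rfl
  · simpa [label] using e.1
  · simpa [label] using e.2

lemma label_two_re_neg (hδ : 0 < δ) : (p.label 0 2 δ).re < 0 := by
  simpa [label] using bot_neg (p := p) hδ

end ZeroMode

end Params

end BZ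

end

theorem lemma3p1 {n : ℕ} (Ω : Set (BZ.E n)) (hΩ_open : IsOpen Ω) (hΩ_conn : IsConnected Ω)
    (hΩ_bdd : Bornology.IsBounded Ω) (p : BZ.Params) :
    -- the eigenvalues `β_{kj}(δ)`; `ev ρ j δ` is `β_{k,j+1}(δ)` for `ρ = ρ_k`
    ∃ ev : ℝ → Fin 3 → ℝ → ℂ, p.IsLabelling Ω ev ∧
      (∀ δ : ℝ, 0 < δ → ∀ z : ℂ,
        p.IsEigenvalue Ω δ z ↔ ∃ ρ ∈ BZ.neumannSpectrum Ω, ∃ j, z = ev ρ j δ) ∧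
      -- the Neumann eigenvalue `ρ₁ = 0` is simple and `e₁` is constant
      (0 ∈ BZ.neumannSpectrum Ω ∧ ∀ e, BZ.IsNeumannEigenfunction Ω 0 e →
        ∃ k : ℂ, ∀ᵐ x ∂(MeasureTheory.volume.restrict Ω), e x = k) ∧
      -- the case `b < 0`
      (p.b < 0 → ∀ δ : ℝ, 0 < δ → ∀ z : ℂ, p.IsEigenvalue Ω δ z → z.re < 0) ∧
      -- the case `b > 0`
      (0 < p.b → ∀ δ₁ : ℝ, p.IsDelta₁ Ω δ₁ →
        -- Assertion (1)
        (p.δ₀ < δ₁ →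
          (∀ ρ₀ : ℝ, p.IsCriticalMode Ω δ₁ ρ₀ →
            (∀ δ : ℝ, 0 < δ →
              (ev ρ₀ 0 δ).im = 0 ∧
              (δ₁ < δ → (ev ρ₀ 0 δ).re < 0) ∧
              (δ = δ₁ → ev ρ₀ 0 δ = 0) ∧
              (δ < δ₁ → 0 < (ev ρ₀ 0 δ).re)) ∧
            (∀ δ : ℝ, δ₁ < δ → ∀ j, (ev ρ₀ j δ).re < 0) ∧
            (∃ ε : ℝ, 0 < ε ∧
              ContinuousOn (ev ρ₀ 0) (Set.Ioo 0 (δ₁ + ε)) ∧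
              ∀ δ ∈ Set.Ioo 0 (δ₁ + ε), ∀ j, j ≠ 0 → ev ρ₀ j δ ≠ ev ρ₀ 0 δ)) ∧
          (∀ ρ ∈ BZ.neumannSpectrum Ω, ∀ j : Fin 3,
            ¬ (p.IsCriticalMode Ω δ₁ ρ ∧ j = 0) → (ev ρ j δ₁).re < 0)) ∧
        -- Assertion (2)
        (δ₁ < p.δ₀ →
          (∃ ε : ℝ, 0 < ε ∧
            ContinuousOn (ev 0 0) (Set.Ioo (p.δ₀ - ε) (p.δ₀ + ε)) ∧
            ∀ δ ∈ Set.Ioo (p.δ₀ - ε) (p.δ₀ + ε),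
              (ev 0 0 δ).im ≠ 0 ∧ ev 0 0 δ = (starRingEnd ℂ) (ev 0 1 δ)) ∧
          (∀ δ : ℝ, 0 < δ → ∀ j : Fin 3, j = 0 ∨ j = 1 →
            (p.δ₀ < δ → (ev 0 j δ).re < 0) ∧
            (δ = p.δ₀ → (ev 0 j δ).re = 0) ∧
            (δ < p.δ₀ → 0 < (ev 0 j δ).re)) ∧
          (∀ ρ ∈ BZ.neumannSpectrum Ω, ∀ j : Fin 3,
            ¬ (ρ = 0 ∧ (j = 0 ∨ j = 1)) → (ev ρ j p.δ₀).re < 0))) := by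
  refine ⟨p.label, p.isLabelling_label Ω, fun δ _ z => ?_,
    ⟨BZ.zero_mem_neumannSpectrum hΩ_open hΩ_conn.nonempty hΩ_bdd,
      fun e he => BZ.neumann_zero_const hΩ_open hΩ_conn hΩ_bdd he⟩,
    fun hb δ hδ z hz => p.eigenvalue_re_neg hb hδ hz, fun hb δ₁ hδ₁ => ?_⟩
  · rw [p.isEigenvalue_iff]
    simp only [p.eval_charpoly, p.cubic_eq_zero_iff]
  have hpos : ∀ ρ ∈ BZ.neumannSpectrum Ω, ρ ≠ 0 → 0 < ρ := fun ρ h h0 =>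
    lt_of_le_of_ne (BZ.neumannSpectrum_nonneg h) h0.symm
  have hδ₀ := (p.δ₀_spec hb).1
  -- maximality in the definition of `δ₁` is nonnegativity of the constant coefficients
  have hle : ∀ ρ ∈ BZ.neumannSpectrum Ω, ρ ≠ 0 → 0 ≤ p.coeff₀ ρ δ₁ := fun ρ h h0 => by
    rw [p.coeff₀_eq_critExpr (hpos ρ h h0)]
    have := hδ₁.2 ⟨ρ, h, h0, rfl⟩
    exact mul_nonneg (p.Q_pos (hpos ρ h h0)).le (by linarith)
  have hcrit : ∀ ρ, p.IsCriticalMode Ω δ₁ ρ → p.coeff₀ ρ δ₁ = 0 := fun ρ h => by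
    rw [p.coeff₀_eq_critExpr (hpos ρ h.1 h.2.1), h.2.2]
    ring
  have hncrit : ∀ ρ ∈ BZ.neumannSpectrum Ω, ρ ≠ 0 → ¬ p.IsCriticalMode Ω δ₁ ρ →
      0 < p.coeff₀ ρ δ₁ := fun ρ h h0 hn => by
    refine lt_of_le_of_ne (hle ρ h h0) fun he => hn ⟨h, h0, ?_⟩
    rw [p.coeff₀_eq_critExpr (hpos ρ h h0)] at he
    have := (mul_eq_zero.1 he.symm).resolve_left (p.Q_pos (hpos ρ h h0)).ne'
    linarith
  refine ⟨fun hlt => ⟨fun ρ hρ => ?_, fun ρ hρ j hj => ?_⟩, fun hlt =>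
    ⟨BZ.Params.exists_pair hb, fun δ hδ j hj => ⟨fun h => ?_, ?_, fun h => ?_⟩,
      fun ρ hρ j hj => ?_⟩⟩
  · have hδ₁0 : 0 < δ₁ := hδ₀.trans hlt
    have h0 := hcrit ρ hρ
    have hρ0 := hpos ρ hρ.1 hρ.2.1
    have h1 : 0 < p.coeff₁ ρ δ₁ :=
      p.coeff₁_pos hρ0.le hδ₁0 (by rw [h0, zero_add]; exact p.hurwitz_pos hb hρ0 hlt.le)
    have hneg : ∀ δ, δ₁ < δ → ∀ j, (p.label ρ j δ).re < 0 := fun δ hδ =>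
      p.label_re_neg hρ0.le (hδ₁0.trans hδ) (h0 ▸ p.coeff₀_lt hρ0.le hδ)
        (p.hurwitz_pos hb hρ0 (hlt.trans hδ).le)
    refine ⟨fun δ _ => ⟨?_, fun h => hneg δ h 0, ?_, fun h => ?_⟩, hneg, ?_⟩
    · rw [p.label_zero hρ0.ne', Complex.ofReal_im]
    · rintro rfl
      rw [p.label_zero hρ0.ne', BZ.Params.top_eq_zero hρ0 hδ₁0 h0 h1, Complex.ofReal_zero]
    · rw [p.label_zero hρ0.ne', Complex.ofReal_re]
      exact BZ.Params.top_pos (h0 ▸ p.coeff₀_lt hρ0.le h)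
    · obtain ⟨ε, hε, h⟩ := BZ.Params.exists_top_simple hρ0 hδ₁0 h0 h1
      refine ⟨ε, hε, fun δ hδ => ContinuousAt.continuousWithinAt ?_, fun δ hδ j hj =>
        BZ.Params.label_ne_label_zero hρ0.ne' (h δ hδ).2 hj⟩
      have e : p.label ρ 0 = fun δ => (p.top ρ δ : ℂ) := funext (p.label_zero hρ0.ne')
      rw [e]
      exact Complex.continuous_ofReal.continuousAt.comp (h δ hδ).1
  · have hδ₁0 : 0 < δ₁ := hδ₀.trans hlt
    rcases eq_or_ne ρ 0 with rfl | hne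
    · exact p.label_re_neg le_rfl hδ₁0 (BZ.Params.coeff₀_zero_pos hδ₁0)
        (p.hurwitz_zero_pos hb hlt) j
    have hρ0 := hpos ρ hρ hne
    have hH := p.hurwitz_pos hb hρ0 hlt.le
    by_cases hc : p.IsCriticalMode Ω δ₁ ρ
    · have h0 := hcrit ρ hc
      exact BZ.Params.label_re_neg_of_critical hρ0 hδ₁0 h0
        (p.coeff₁_pos hρ0.le hδ₁0 (by rw [h0, zero_add]; exact hH)) fun h => hj ⟨hc, h⟩
    · exact p.label_re_neg hρ0.le hδ₁0 (hncrit ρ hρ hne hc) hH j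
  · exact p.label_re_neg le_rfl hδ (BZ.Params.coeff₀_zero_pos hδ) (p.hurwitz_zero_pos hb h) j
  · rintro rfl
    exact BZ.Params.pair_re_eq_zero hb hj
  · exact BZ.Params.pair_re_pos hb hδ h hj
  · rcases eq_or_ne ρ 0 with rfl | hne
    · have : j = 2 := by
        fin_cases j <;> simp_all
      rw [this]
      exact BZ.Params.label_two_re_neg hδ₀
    · have hρ0 := hpos ρ hρ hne
      exact p.label_re_neg hρ0.le hδ₀ ((hle ρ hρ hne).trans_lt (p.coeff₀_lt hρ0.le hlt))
        (p.hurwitz_pos hb hρ0 le_rfl) j
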